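/- Let $d\ge 2$ and let $\delta,R,C^{\mathrm{in}}>0$ and $0<\gamma=\tau<1$ be fixed. For $\varepsilon>0$ put $$M_\varepsilon(v)=\frac1\delta\Big(1+\exp\Big(\frac{|v|^2-R^2}{\varepsilon^\tau}\Big)\Big)^{-1},\qquad v\in\mathbb R^d,\qquad h(z,a)=z\log\frac za+(1-z)\log\frac{1-z}{1-a}\quad (z\in[0,1],\ a\in(0,1)).$$ Let $f_\varepsilon(t,x,v)$, $\varepsilon>0$, be a family of measurable functions on $[0,\infty)\times\mathbb R^d\times\mathbb R^d$ with $0\le f_\varepsilon\le\delta^{-1}$ and $$\frac1{\varepsilon^{2-\gamma}}\int_{\mathbb R^d\times\mathbb R^d}h(\delta f_\varepsilon(t,x,v),\delta M_\varepsilon(v))\,dxdv\le C^{\mathrm{in}}\qquad\text{for all }\varepsilon>0\text{ and almost every }t\ge0 .$$ Define the fluctuations $g_\varepsilon$ by $f_\varepsilon=M_\varepsilon+\varepsilon g_\varepsilon$, and the dilated fluctuations, for $t\ge0$, $x\in\mathbb R^d$, $u\in\mathbb R$ and $\omega\in\partial B(0,R)$, by $$\widetilde g_\varepsilon(t,x,u,\omega)=\frac{\varepsilon^\tau|v|^{d-2}}{2R^{d-1}}\,g_\varepsilon(t,x,v)\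 \text{ if }u\ge-\frac{R^2}{\varepsilon^\tau},\qquad \widetilde g_\varepsilon=0\ \text{ otherwise},\qquad\text{where } v=v_\varepsilon(u,\omega)=\Big(1+\frac{\varepsilon^\tau}{R^2}u\Big)^{\frac12}\omega .$$ Here $d\omega$ is the surface measure on $\partial B(0,R)$, "loc" refers to compact subsets of $[0,\infty)\times\mathbb R^d$ or of $\mathbb R^d$, and weak convergence in $L^1_{\mathrm{loc}}(dtdx;L^1(dud\omega))$ is convergence of the integrals against every bounded measurable function that vanishes for $(t,x)$ outside a compact set. Weak convergence in $L^1_{\mathrm{loc}}(dtdx;L^1((1+|u|)dud\omega))$ means weak convergence, in the former space, after multiplication by $1+|u|$. Then: 1. For every compact $K\subset\mathbb R^d$ and every $\varepsilon_0>0$, $$\sup_{0<\varepsilon\le\varepsilon_0}\ \operatorname*{ess\,sup}_{t\ge0}\int_{K\times\mathbb R\times\partial B(0,R)}(1+|u|)\,|\widetilde g_\varepsilon|\,dxdud\omega<\infty ,$$ that is, $(1+|u|)\widetilde g_\varepsilon$ is uniformly bounded in $L^\infty(dt;L^1_{\mathrm{loc}}(dx;L^1(dud\omega)))$. 2. For every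 sequence $\varepsilon_n\to0$ of positive numbers, $\{(1+|u|)\widetilde g_{\varepsilon_n}:n\in\mathbb N\}$ is weakly relatively compact in $L^1_{\mathrm{loc}}(dtdx;L^1(dud\omega))$, and some subsequence of $\widetilde g_{\varepsilon_n}$ converges weakly in $L^1_{\mathrm{loc}}(dtdx;L^1((1+|u|)dud\omega))$. Moreover, for some subsequence, the fluctuations $g_{\varepsilon_n}$ converge weakly* in the space of locally finite Radon measures on $[0,\infty)\times\mathbb R^d\times\mathbb R^d$ to a measure of the form $g(t,x,R\frac v{|v|})\,dt\otimes dx\otimes\delta_{\partial B(0,R)}(v)$ with $g(t,x,\omega)\in L^\infty(dt;L^2(\mathbb R^d\times\partial B(0,R)))$, where $\delta_{\partial B(0,R)}$ is the surface measure of $\partial B(0,R)$. 3. Let $\varepsilon_n\to0$ be a sequence of positive numbers along which $\widetilde g_{\varepsilon_n}$ converges weakly in $L^1_{\mathrm{loc}}(dtdx;L^1((1+|u|)dud\omega))$ to $\widetilde g$. Then: (a) if $g_{\varepsilon_n}$ converges weakly* to a measure of the above form with density $g\in L^\infty(dt;L^2(\mathbb R^d\times\partial B(0,R)))$, then, for almost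 every $(t,x,\omega)$, the function $u\mapsto\widetilde g(t,x,u,\omega)$ is integrable and $$\int_{\mathbb R}\widetilde g(t,x,u,\omega)\,du=g(t,x,\omega);$$ (b) for almost every $t\ge0$, $$\int_{\mathbb R^d\times\mathbb R\times\partial B(0,R)}\Big(\widetilde g(t,x,u,\omega)\cosh\Big(\frac u2\Big)\Big)^2dxdud\omega\le\frac{C^{\mathrm{in}}}{4R\delta^2};$$ (c) for every continuous function $\varphi(t,x,u,v)$ on $[0,\infty)\times\mathbb R^d\times\mathbb R\times\mathbb R^d$ that is compactly supported in $(t,x)$ and such that $\varphi/(1+|u|)$ is bounded, $$\int\widetilde g_{\varepsilon_n}(t,x,u,\omega)\,\varphi(t,x,u,v_{\varepsilon_n}(u,\omega))\,dtdxdud\omega\ \longrightarrow\ \int\widetilde g(t,x,u,\omega)\,\varphi(t,x,u,\omega)\,dtdxdud\omega ,$$ both integrals being over $[0,\infty)\times\mathbb R^d\times\mathbb R\times\partial B(0,R)$. -/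

import Mathlib

open MeasureTheory Set Filter Topology

namespace FermiGas

/-- The space `ℝ^d` of positions, and also of velocities. -/
abbrev Sp (d : ℕ) := EuclideanSpace ℝ (Fin d)

/-- The dilated phase space, with points `((t, x), (u, ω))`. The velocity direction `ω` is a point
of `ℝ^d`; only points of the sphere of radius `R` are charged by the measure used below. -/
abbrev Phase (d : ℕ) := (ℝ × Sp d) × (ℝ × Sp d)

/-! ### Measures -/

/-- Lebesgue measure on the time half-line `[0, ∞)`. -/
noncomputable def timeMeasure : Measure ℝ := volume.restrict (Ici 0)

/-- The measure `dt dx` on `[0, ∞) × ℝ^d`. -/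
noncomputable def timeSpaceMeasure (d : ℕ) : Measure (ℝ × Sp d) :=
  timeMeasure.prod volume

/-- The surface measure `dω` of the sphere `∂B(0, R)`, seen as a measure on `ℝ^d`: the image of the
surface measure of the unit sphere under `σ ↦ R σ`, multiplied by `R^(d-1)`. -/
noncomputable def sphereMeasure (d : ℕ) (R : ℝ) : Measure (Sp d) :=
  ENNReal.ofReal (R ^ (d - 1)) •
    Measure.map (fun σ : Metric.sphere (0 : Sp d) 1 => R • (σ : Sp d))
      (volume : Measure (Sp d)).toSphere

/-- The measure `du dω` on `ℝ × ∂B(0, R)`. -/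
noncomputable def energySphereMeasure (d : ℕ) (R : ℝ) : Measure (ℝ × Sp d) :=
  (volume : Measure ℝ).prod (sphereMeasure d R)

/-- The measure `dt dx du dω` on `[0, ∞) × ℝ^d × ℝ × ∂B(0, R)`. -/
noncomputable def phaseMeasure (d : ℕ) (R : ℝ) : Measure (Phase d) :=
  (timeSpaceMeasure d).prod (energySphereMeasure d R)

/-! ### Equilibria, relative entropy, fluctuations -/

/-- The low-temperature Fermi--Dirac distribution
`M_ε(v) = δ⁻¹ (1 + exp ((|v|² - R²) / ε^τ))⁻¹`. -/
noncomputable def fermiDirac {d : ℕ} (δ R τ ε : ℝ) (v : Sp d) : ℝ :=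
  (1 / δ) * (1 + Real.exp ((‖v‖ ^ 2 - R ^ 2) / ε ^ τ))⁻¹

/-- The entropy function `h(z, a) = z log (z/a) + (1-z) log ((1-z)/(1-a))` on `[0,1] × (0,1)`
(with the convention `0 log 0 = 0`). -/
noncomputable def entropyFn (z a : ℝ) : ℝ :=
  z * Real.log (z / a) + (1 - z) * Real.log ((1 - z) / (1 - a))

/-- The relative entropy `H(f | M_ε) = ∫∫ h(δ f, δ M_ε) dx dv ∈ [0, ∞]` of a density `f(x, v)`. -/
noncomputable def relEntropy {d : ℕ} (δ R τ ε : ℝ) (f : Sp d → Sp d → ℝ) : ENNReal :=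
  ∫⁻ p : Sp d × Sp d,
    ENNReal.ofReal (entropyFn (δ * f p.1 p.2) (δ * fermiDirac δ R τ ε p.2))
    ∂((volume : Measure (Sp d)).prod (volume : Measure (Sp d)))

/-- A family `f_ε(t, x, v)`, `ε > 0`, of (measurable) densities with `0 ≤ f_ε ≤ δ⁻¹` almost
everywhere, satisfying `ε^(γ-2) H(f_ε | M_ε)(t) ≤ Cin` for almost every `t ≥ 0`, for all `ε > 0`. -/
structure IsEntropyBoundedFamily (d : ℕ) (δ R τ γ Cin : ℝ)
    (f : ℝ → ℝ → Sp d → Sp d → ℝ) : Prop where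
  aemeasurable : ∀ ε > 0, AEMeasurable (fun p : (ℝ × Sp d) × Sp d => f ε p.1.1 p.1.2 p.2)
    ((timeSpaceMeasure d).prod volume)
  bounds : ∀ ε > 0, ∀ᵐ p : (ℝ × Sp d) × Sp d ∂((timeSpaceMeasure d).prod volume),
    0 ≤ f ε p.1.1 p.1.2 p.2 ∧ f ε p.1.1 p.1.2 p.2 ≤ δ⁻¹
  entropy : ∀ ε > 0, ∀ᵐ t ∂timeMeasure,
    ENNReal.ofReal (1 / ε ^ (2 - γ)) * relEntropy δ R τ ε (f ε t) ≤ ENNReal.ofReal Cin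

/-- The fluctuation `g_ε`, defined by `f_ε = M_ε + ε g_ε`. -/
noncomputable def fluctuation {d : ℕ} (δ R τ : ℝ) (f : ℝ → ℝ → Sp d → Sp d → ℝ)
    (ε t : ℝ) (x v : Sp d) : ℝ :=
  (f ε t x v - fermiDirac δ R τ ε v) / ε

/-- The velocity `v = (1 + ε^τ u / R²)^(1/2) ω` with energy level `u` and direction `ω`. -/
noncomputable def dilVelocity {d : ℕ} (R τ ε u : ℝ) (ω : Sp d) : Sp d :=
  Real.sqrt (1 + ε ^ τ / R ^ 2 * u) • ω

open Classical in
/-- The dilated fluctuation `g̃_ε(t, x, u, ω)`, equal to `ε^τ |v|^(d-2) / (2 R^(d-1)) g_ε(t, x, v)`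
for `u ≥ -R² / ε^τ` and to zero for smaller `u`. -/
noncomputable def dilFluctuation {d : ℕ} (δ R τ : ℝ) (f : ℝ → ℝ → Sp d → Sp d → ℝ)
    (ε : ℝ) (p : Phase d) : ℝ :=
  if -(R ^ 2 / ε ^ τ) ≤ p.2.1 then
    ε ^ τ * ‖dilVelocity R τ ε p.2.1 p.2.2‖ ^ (d - 2) / (2 * R ^ (d - 1)) *
      fluctuation δ R τ f ε p.1.1 p.1.2 (dilVelocity R τ ε p.2.1 p.2.2)
  else 0

/-- Multiplication by the weight `1 + |u|`. A function `F` belongs to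
`L¹_loc(dtdx; L¹((1+|u|)dudω))` if and only if `(1+|u|) F` belongs to `L¹_loc(dtdx; L¹(dudω))`, and
weak convergence in the first space is weak convergence of the weighted functions in the second. -/
def weighted {d : ℕ} (F : Phase d → ℝ) (p : Phase d) : ℝ := (1 + |p.2.1|) * F p

/-! ### The space `L¹_loc(dtdx; L¹(dudω))` and its weak topology -/

/-- Membership in `L¹_loc(dtdx; L¹(dudω))`: integrability on `K × ℝ × ∂B(0, R)` for every compact
set `K` of times and positions. -/
def MemL1loc (d : ℕ) (R : ℝ) (F : Phase d → ℝ) : Prop :=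
  ∀ K : Set (ℝ × Sp d), IsCompact K → IntegrableOn F (K ×ˢ univ) (phaseMeasure d R)

/-- The elements of the dual of `L¹_loc(dtdx; L¹(dudω))`: bounded measurable functions that vanish
for `(t, x)` outside some compact set. -/
def IsDualTest {d : ℕ} (ψ : Phase d → ℝ) : Prop :=
  Measurable ψ ∧ (∃ C : ℝ, ∀ p, |ψ p| ≤ C) ∧
    ∃ K : Set (ℝ × Sp d), IsCompact K ∧ ∀ p : Phase d, p.1 ∉ K → ψ p = 0

/-- The weak topology of `L¹_loc(dtdx; L¹(dudω))`: the coarsest one for which all the functionals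
`F ↦ ∫ F ψ dtdxdudω` are continuous. (It does not separate almost everywhere equal functions.) -/
@[reducible] noncomputable def weakTopology (d : ℕ) (R : ℝ) :
    TopologicalSpace {F : Phase d → ℝ // MemL1loc d R F} :=
  ⨅ ψ : {ψ : Phase d → ℝ // IsDualTest ψ},
    TopologicalSpace.induced (fun F => ∫ p, F.1 p * ψ.1 p ∂(phaseMeasure d R)) inferInstance

/-- `S` is a weakly relatively compact subset of `L¹_loc(dtdx; L¹(dudω))`: it is contained in
this space and its weak closure is weakly compact. -/
def WeaklyRelCompact (d : ℕ) (R : ℝ) (S : Set (Phase d → ℝ)) : Prop :=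
  (∀ F ∈ S, MemL1loc d R F) ∧
    @IsCompact _ (weakTopology d R) (@closure _ (weakTopology d R) (Subtype.val ⁻¹' S))

/-- Weak convergence `F_n ⇀ F` of a sequence in `L¹_loc(dtdx; L¹(dudω))`. -/
def WeakTendsto (d : ℕ) (R : ℝ) (F : ℕ → Phase d → ℝ) (G : Phase d → ℝ) : Prop :=
  (∀ n, MemL1loc d R (F n)) ∧ MemL1loc d R G ∧
    ∀ ψ : Phase d → ℝ, IsDualTest ψ →
      Tendsto (fun n => ∫ p, F n p * ψ p ∂(phaseMeasure d R)) atTop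
        (𝓝 (∫ p, G p * ψ p ∂(phaseMeasure d R)))

/-! ### Limits of the fluctuations -/

/-- Membership of `g(t, x, ω)` in `L^∞(dt; L²(ℝ^d × ∂B(0, R)))`. -/
def MemLinftyL2 (d : ℕ) (R : ℝ) (g : (ℝ × Sp d) × Sp d → ℝ) : Prop :=
  AEStronglyMeasurable g ((timeSpaceMeasure d).prod (sphereMeasure d R)) ∧
    ∃ C : NNReal, ∀ᵐ t ∂timeMeasure,
      ∫⁻ z : Sp d × Sp d, ENNReal.ofReal ((g ((t, z.1), z.2)) ^ 2)
        ∂((volume : Measure (Sp d)).prod (sphereMeasure d R)) ≤ (C : ENNReal)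

/-- Weak* convergence, in the space of locally finite Radon measures on `[0, ∞) × ℝ^d × ℝ^d`, of
the measures `G_n(t, x, v) dt dx dv` to `g(t, x, R v/|v|) dt ⊗ dx ⊗ δ_{∂B(0, R)}(v)`, where
`δ_{∂B(0, R)}` is the surface measure (on whose support `R v/|v| = v`). The test functions on
`[0, ∞) × ℝ^d × ℝ^d` are the restrictions of those on `ℝ × ℝ^d × ℝ^d`. -/
def WeakStarTendsto (d : ℕ) (R : ℝ) (G : ℕ → ℝ → Sp d → Sp d → ℝ)
    (g : (ℝ × Sp d) × Sp d → ℝ) : Prop :=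
  ∀ φ : (ℝ × Sp d) × Sp d → ℝ, Continuous φ → HasCompactSupport φ →
    Tendsto (fun n => ∫ p, G n p.1.1 p.1.2 p.2 * φ p ∂((timeSpaceMeasure d).prod volume)) atTop
      (𝓝 (∫ p, g p * φ p ∂((timeSpaceMeasure d).prod (sphereMeasure d R))))

/-- The test functions `φ(t, x, u, v)`: continuous on `[0, ∞) × ℝ^d × ℝ × ℝ^d`, compactly supported
in `(t, x)`, and such that `φ / (1 + |u|)` is bounded. -/
def IsGrowthTest {d : ℕ} (φ : Phase d → ℝ) : Prop :=
  ContinuousOn φ {p | 0 ≤ p.1.1} ∧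
    (∃ K : Set (ℝ × Sp d), IsCompact K ∧ ∀ p : Phase d, 0 ≤ p.1.1 → p.1 ∉ K → φ p = 0) ∧
    ∃ C : ℝ, ∀ p : Phase d, 0 ≤ p.1.1 → |φ p| / (1 + |p.2.1|) ≤ C

end FermiGas

namespace FermiGas

/-! ### Convex duality for the entropy function -/

/-! The entropy bound is used only through convex duality. Young's inequality and an estimate of the
Legendre transform of `h(·, a)` give `l (z - a) ≤ h(z, a) + a (1 - a) l² exp |l| / 2` for every real
`l`. In the variables `(u, ω)` the rescaled equilibrium is `a = (1 + exp u)⁻¹`, so `a (1 - a) = 1 /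
(4 cosh² (u/2))`, and `dv = ε^τ j du dω` with `j → 1 / (2R)`. Put `η = ε^(1-τ)`. Replacing `l` by `η
l`, dividing by `η²` and using `γ = τ` gives `δ g̃ l ≤ E + j l² exp (η |l|) / (8 cosh² (u/2))`,
where `E ≥ 0` has `dx du dω`-integral at most `Cin` for almost every `t`. This is
`EntropyDominated`. The rest of the proof consists in choosing `l`, knowing that `η → 0` and that
the quadratic term decays like `exp (-|u|)`.

The uniform bound comes from `l` proportional to `±(1 + |u|)`. For compactness, `exists_split` cuts
`(1 + |u|) g̃` at a threshold: below it, the inequality bounds an exponentially weighted `L²` norm;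
above it, the function is at most a multiple of `η E`, which vanishes in `L¹`. Weak compactness thus
reduces to that of balls in a Hilbert space.

For the `cosh` bound, a fixed bounded `l = ψ` is inserted and `n → ∞` (`DominatedSeq.integral_le`).
The best choice is `ψ = 8 R δ g̃ cosh² (u/2)`, truncated; it turns the inequality into the sharp
estimate on almost every time slice. The `L²` structure also allows test functions that depend on
`n` and converge pointwise, which gives (c). Testing with functions of `(t, x, v)` and integrating
out `u` shows that `g_ε` converges weakly* to `∫ g̃ du`; Cauchy-Schwarz against `1 / cosh` puts this
density in `L²`, and uniqueness of the limit gives (a). -/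

theorem sub_le_mul_log_div {x p : ℝ} (hx : 0 ≤ x) (hp : 0 < p) :
    x - p ≤ x * Real.log (x / p) := by
  rcases hx.eq_or_lt with rfl | hx
  · simp [hp.le]
  · have h := Real.one_sub_inv_le_log_of_pos (div_pos hx hp)
    have := mul_le_mul_of_nonneg_left h hx.le
    calc x - p = x * (1 - (x / p)⁻¹) := by field_simp
      _ ≤ _ := this

theorem entropyFn_nonneg {z a : ℝ} (hz : 0 ≤ z) (hz' : z ≤ 1) (ha : 0 < a) (ha' : a < 1) :
    0 ≤ entropyFn z a := by
  have h1 := sub_le_mul_log_div hz ha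
  have h2 := sub_le_mul_log_div (sub_nonneg.2 hz') (sub_pos.2 ha')
  unfold entropyFn
  linarith

theorem mul_log_div_mul {x p c : ℝ} (hp : p ≠ 0) (hc : c ≠ 0) :
    x * Real.log (x / (p * c)) = x * Real.log (x / p) - x * Real.log c := by
  rcases eq_or_ne x 0 with rfl | hx
  · simp
  · rw [← div_div, Real.log_div (div_ne_zero hx hp) hc, mul_sub]

/-- Young's inequality for the entropy function and its Legendre transform. -/
theorem mul_sub_le_entropyFn_add {z a : ℝ} (hz : 0 ≤ z) (hz' : z ≤ 1) (ha : 0 < a) (ha' : a < 1)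
    (l : ℝ) :
    l * (z - a) ≤ entropyFn z a + (Real.log (1 + a * (Real.exp l - 1)) - a * l) := by
  set D := 1 + a * (Real.exp l - 1) with hD
  have he := Real.exp_pos l
  have hDpos : 0 < D := by nlinarith [mul_pos ha he]
  have ha1 : 0 < 1 - a := sub_pos.2 ha'
  -- The claim is `h(z, p) ≥ 0` for the exponentially tilted parameter `p = a exp l / D`, for which
  -- `1 - p = (1 - a) / D`.
  have hp : 0 < a * (Real.exp l / D) := by positivity
  have hq : 1 - a * (Real.exp l / D) = (1 - a) * D⁻¹ := by
    field_simp; rw [hD]; ring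
  have hq' : 0 < (1 - a) * D⁻¹ := by positivity
  have h := entropyFn_nonneg hz hz' hp (by linarith)
  unfold entropyFn at h ⊢
  rw [hq, mul_log_div_mul ha.ne' (by positivity), mul_log_div_mul ha1.ne' (by positivity),
    Real.log_div he.ne' hDpos.ne', Real.log_exp, Real.log_inv] at h
  linarith

/-- Right side minus left side vanishes at `0` and has derivative `a² (1 - a) (exp x - 1)² / (1 + a
(exp x - 1)) ≥ 0`. -/
theorem log_one_add_mul_exp_sub_le_of_nonneg {a l : ℝ} (ha : 0 < a) (ha' : a < 1) (hl : 0 ≤ l) :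
    Real.log (1 + a * (Real.exp l - 1)) - a * l ≤ a * (1 - a) * (Real.exp l - 1 - l) := by
  let F : ℝ → ℝ := fun x => a * (1 - a) * (Real.exp x - 1 - x) -
    (Real.log (1 + a * (Real.exp x - 1)) - a * x)
  have hDpos : ∀ x, 0 < 1 + a * (Real.exp x - 1) := fun x => by
    nlinarith [mul_pos ha (Real.exp_pos x)]
  have hF : ∀ x, HasDerivAt F (a * (1 - a) * (Real.exp x - 1) -
      (a * Real.exp x / (1 + a * (Real.exp x - 1)) - a)) x := by
    intro x
    have h1 := ((((Real.hasDerivAt_exp x).sub_const 1).sub (hasDerivAt_id x)).const_mul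
      (a * (1 - a)))
    have h2 := (((((Real.hasDerivAt_exp x).sub_const 1).const_mul a).const_add 1).log
      (hDpos x).ne').sub ((hasDerivAt_id x).const_mul a)
    exact (h1.sub h2).congr_deriv (by simp)
  have hmono : MonotoneOn F (Ici 0) := by
    apply monotoneOn_of_deriv_nonneg (convex_Ici 0)
    · exact fun x _ => (hF x).continuousAt.continuousWithinAt
    · exact fun x _ => (hF x).differentiableAt.differentiableWithinAt
    · intro x hx
      rw [interior_Ici] at hx
      have hx1 : 0 ≤ Real.exp x - 1 := sub_nonneg.2 (Real.one_le_exp (le_of_lt hx))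
      rw [(hF x).deriv]
      have hD := hDpos x
      have : a * (1 - a) * (Real.exp x - 1) -
          (a * Real.exp x / (1 + a * (Real.exp x - 1)) - a) =
          a * (1 - a) * (Real.exp x - 1) * (a * (Real.exp x - 1)) /
            (1 + a * (Real.exp x - 1)) := by
        field_simp; ring
      rw [this]
      have := sub_pos.2 ha'
      positivity
  have h := hmono (mem_Ici.2 le_rfl) (mem_Ici.2 hl) hl
  simp only [F] at h
  simp at h
  linarith

/-- The left side is invariant under `(a, l) ↦ (1 - a, -l)`, which reduces negative `l` to positive
`l`. -/
theorem log_one_add_mul_exp_sub_le {a : ℝ} (ha : 0 < a) (ha' : a < 1) (l : ℝ) :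
    Real.log (1 + a * (Real.exp l - 1)) - a * l ≤ a * (1 - a) * (Real.exp |l| - 1 - |l|) := by
  rcases le_total 0 l with hl | hl
  · rw [abs_of_nonneg hl]
    exact log_one_add_mul_exp_sub_le_of_nonneg ha ha' hl
  · rw [abs_of_nonpos hl]
    have h := log_one_add_mul_exp_sub_le_of_nonneg (sub_pos.2 ha') (sub_lt_self 1 ha)
      (neg_nonneg.2 hl)
    have hpos : 0 < 1 + (1 - a) * (Real.exp (-l) - 1) := by
      nlinarith [mul_pos (sub_pos.2 ha') (Real.exp_pos (-l))]
    have he : 1 + a * (Real.exp l - 1) = Real.exp l * (1 + (1 - a) * (Real.exp (-l) - 1)) := by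
      rw [Real.exp_neg]; field_simp; ring
    rw [he, Real.log_mul (Real.exp_pos l).ne' hpos.ne', Real.log_exp]
    linarith

theorem exp_sub_one_sub_le {x : ℝ} (hx : 0 ≤ x) :
    Real.exp x - 1 - x ≤ x ^ 2 / 2 * Real.exp x := by
  let F : ℝ → ℝ := fun y => y ^ 2 / 2 * Real.exp y - (Real.exp y - 1 - y)
  have hF : ∀ y, HasDerivAt F (y * Real.exp y + y ^ 2 / 2 * Real.exp y - (Real.exp y - 1)) y := by
    intro y
    have h1 := (((hasDerivAt_id y).pow 2).div_const 2).mul (Real.hasDerivAt_exp y)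
    have h2 := ((Real.hasDerivAt_exp y).sub_const 1).sub (hasDerivAt_id y)
    exact (h1.sub h2).congr_deriv (by simp)
  have hmono : MonotoneOn F (Ici 0) := by
    apply monotoneOn_of_deriv_nonneg (convex_Ici 0)
    · exact fun y _ => (hF y).continuousAt.continuousWithinAt
    · exact fun y _ => (hF y).differentiableAt.differentiableWithinAt
    · intro y hy
      rw [(hF y).deriv]
      have h1 : (1 - y) * Real.exp y ≤ 1 := by
        have := Real.add_one_le_exp (-y)
        calc (1 - y) * Real.exp y ≤ Real.exp (-y) * Real.exp y := by gcongr; linarith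
          _ = 1 := by rw [← Real.exp_add]; simp
      have : 0 ≤ y ^ 2 / 2 * Real.exp y := by positivity
      nlinarith
  have h := hmono (mem_Ici.2 le_rfl) (mem_Ici.2 hx) hx
  simp only [F] at h
  simp at h
  linarith

/-- Half the variance `a (1 - a)` of the Fermi--Dirac occupation number `a = (1 + exp u)⁻¹`. -/
noncomputable def halfVariance (u : ℝ) : ℝ := 1 / (8 * Real.cosh (u / 2) ^ 2)

theorem halfVariance_pos (u : ℝ) : 0 < halfVariance u := by
  have := Real.cosh_pos (u / 2)
  unfold halfVariance; positivity

theorem continuous_halfVariance : Continuous halfVariance := by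
  unfold halfVariance
  refine continuous_const.div (by fun_prop) fun u => ?_
  have := Real.cosh_pos (u / 2)
  positivity

/-- This decay absorbs every polynomial factor below: those of the Jacobian and those of the weight
`1 + |u|`. -/
theorem halfVariance_le (u : ℝ) : halfVariance u ≤ Real.exp (-|u|) / 2 := by
  have h1 : Real.exp (|u| / 2) / 2 ≤ Real.cosh (u / 2) := by
    rw [← Real.cosh_abs, abs_div, abs_two, Real.cosh_eq]
    have := Real.exp_pos (-(|u| / 2))
    linarith
  have h2 : Real.exp (|u|) / 4 ≤ Real.cosh (u / 2) ^ 2 := by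
    calc Real.exp (|u|) / 4 = (Real.exp (|u| / 2) / 2) ^ 2 := by
          rw [div_pow, ← Real.exp_nat_mul]; push_cast; ring_nf
      _ ≤ _ := by gcongr
  unfold halfVariance
  rw [Real.exp_neg, div_le_iff₀ (by have := Real.cosh_pos (u / 2); positivity)]
  have := Real.exp_pos |u|
  calc (1 : ℝ) = (Real.exp |u|)⁻¹ / 2 * (8 * (Real.exp |u| / 4)) := by field_simp; norm_num
    _ ≤ _ := by gcongr

theorem occupation_variance (u : ℝ) :
    (1 + Real.exp u)⁻¹ * (1 - (1 + Real.exp u)⁻¹) = 2 * halfVariance u := by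
  have h : Real.cosh (u / 2) ^ 2 = (1 + Real.exp u) ^ 2 / (4 * Real.exp u) := by
    have : Real.exp u = Real.exp (u / 2) ^ 2 := by
      rw [← Real.exp_nat_mul]; push_cast; ring_nf
    rw [Real.cosh_eq, Real.exp_neg, this]
    have := Real.exp_pos (u / 2)
    field_simp
    ring
  have := Real.exp_pos u
  rw [halfVariance, h]
  field_simp
  ring

/-- The entropy controls every linear functional of the fluctuation, up to a quadratic term. -/
theorem mul_sub_le_entropyFn_add_sq {z : ℝ} (hz : 0 ≤ z) (hz' : z ≤ 1) (u l : ℝ) :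
    l * (z - (1 + Real.exp u)⁻¹) ≤
      entropyFn z (1 + Real.exp u)⁻¹ + l ^ 2 * Real.exp |l| * halfVariance u := by
  have he := Real.exp_pos u
  have ha : 0 < (1 + Real.exp u)⁻¹ := by positivity
  have ha' : (1 + Real.exp u)⁻¹ < 1 := inv_lt_one_of_one_lt₀ (by linarith)
  have h1 := mul_sub_le_entropyFn_add hz hz' ha ha' l
  have h2 := log_one_add_mul_exp_sub_le ha ha' l
  have h3 := exp_sub_one_sub_le (abs_nonneg l)
  rw [occupation_variance] at h2
  rw [sq_abs] at h3
  have := halfVariance_pos u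
  nlinarith [mul_le_mul_of_nonneg_left h3 this.le]

/-! ### Polar coordinates adapted to the energy level -/

theorem lintegral_eq_lintegral_sphere_Ioi {d : ℕ} (hd : 1 ≤ d) {F : Sp d → ENNReal}
    (hF : Measurable F) :
    ∫⁻ v, F v = ∫⁻ σ : Metric.sphere (0 : Sp d) 1, (∫⁻ r in Ioi (0 : ℝ),
      ENNReal.ofReal (r ^ (d - 1)) * F (r • (σ : Sp d))) ∂(volume : Measure (Sp d)).toSphere := by
  have : Nonempty (Fin d) := ⟨⟨0, hd⟩⟩
  have hdim : Module.finrank ℝ (Sp d) = d := by simp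
  have hmp := (volume : Measure (Sp d)).measurePreserving_homeomorphUnitSphereProd
  rw [hdim] at hmp
  let G : Metric.sphere (0 : Sp d) 1 × Ioi (0 : ℝ) → ENNReal := fun p => F ((p.2 : ℝ) • (p.1 : Sp d))
  have hG : Measurable G := by
    apply hF.comp; fun_prop
  have h0 : MeasurableSet ({0}ᶜ : Set (Sp d)) := (measurableSet_singleton _).compl
  have hFG : ∀ x : ({0}ᶜ : Set (Sp d)), F x = G (homeomorphUnitSphereProd (Sp d) x) := by
    intro x
    have h := congrArg Subtype.val ((homeomorphUnitSphereProd (Sp d)).symm_apply_apply x)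
    rw [homeomorphUnitSphereProd_symm_apply_coe] at h
    simp only [G]
    rw [h]
  calc ∫⁻ v, F v = ∫⁻ v in ({0}ᶜ : Set (Sp d)), F v := by
        rw [restrict_compl_singleton]
    _ = ∫⁻ x : ({0}ᶜ : Set (Sp d)), F x ∂(Measure.comap Subtype.val volume) :=
        (lintegral_subtype_comap h0 F).symm
    _ = ∫⁻ p, G p ∂((volume : Measure (Sp d)).toSphere.prod (Measure.volumeIoiPow (d - 1))) := by
        simp_rw [hFG]
        exact hmp.lintegral_comp hG
    _ = _ := by
        rw [lintegral_prod _ hG.aemeasurable]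
        refine lintegral_congr fun σ => ?_
        have hr : Measurable fun r : ℝ => F (r • (σ : Sp d)) := hF.comp (by fun_prop)
        have hr' : Measurable fun r : Ioi (0 : ℝ) => G (σ, r) := hr.comp measurable_subtype_coe
        rw [Measure.volumeIoiPow, lintegral_withDensity_eq_lintegral_mul _ (by fun_prop) hr']
        exact lintegral_subtype_comap measurableSet_Ioi
          (fun r : ℝ => ENNReal.ofReal (r ^ (d - 1)) * F (r • (σ : Sp d)))

/-- The speed at energy level `u`. -/
noncomputable def speed (R s u : ℝ) : ℝ := R * Real.sqrt (1 + s / R ^ 2 * u)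

theorem one_add_pos_iff {R s u : ℝ} (hR : 0 < R) (hs : 0 < s) :
    0 < 1 + s / R ^ 2 * u ↔ -(R ^ 2 / s) < u := by
  have : 1 + s / R ^ 2 * u = s / R ^ 2 * (u + R ^ 2 / s) := by field_simp; ring
  rw [this, mul_pos_iff_of_pos_left (by positivity)]
  constructor <;> intro h <;> linarith

/-- The substitution is `r² = R² + s u`, so `dr = s du / (2 r)`. -/
theorem lintegral_Ioi_eq_lintegral_speed {R s : ℝ} (hR : 0 < R) (hs : 0 < s) (G : ℝ → ENNReal) :
    ∫⁻ r in Ioi (0 : ℝ), G r =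
      ∫⁻ u in Ioi (-(R ^ 2 / s)), ENNReal.ofReal (s / (2 * speed R s u)) * G (speed R s u) := by
  have himg : speed R s '' Ioi (-(R ^ 2 / s)) = Ioi 0 := by
    ext r
    simp only [mem_image, mem_Ioi]
    constructor
    · rintro ⟨u, hu, rfl⟩
      exact mul_pos hR (Real.sqrt_pos.2 ((one_add_pos_iff hR hs).2 hu))
    · intro hr
      have h1 : 1 + s / R ^ 2 * ((r ^ 2 - R ^ 2) / s) = (r / R) ^ 2 := by field_simp; ring
      refine ⟨(r ^ 2 - R ^ 2) / s, ?_, ?_⟩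
      · rw [← one_add_pos_iff hR hs, h1]; positivity
      · rw [speed, h1, Real.sqrt_sq (by positivity)]; field_simp
  have hder : ∀ u ∈ Ioi (-(R ^ 2 / s)),
      HasDerivWithinAt (speed R s) (s / (2 * speed R s u)) (Ioi (-(R ^ 2 / s))) u := by
    intro u hu
    have hpos := (one_add_pos_iff hR hs).2 hu
    have h1 : HasDerivAt (fun u => 1 + s / R ^ 2 * u) (s / R ^ 2) u :=
      (((hasDerivAt_id u).const_mul (s / R ^ 2)).const_add 1).congr_deriv (by simp)
    refine (((h1.sqrt hpos.ne').const_mul R).congr_deriv ?_).hasDerivWithinAt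
    have := Real.sqrt_pos.2 hpos
    unfold speed
    field_simp
  have hinj : InjOn (speed R s) (Ioi (-(R ^ 2 / s))) := by
    intro u hu w hw h
    have hu' := (one_add_pos_iff hR hs).2 hu
    have hw' := (one_add_pos_iff hR hs).2 hw
    unfold speed at h
    have h2 := (Real.sqrt_inj hu'.le hw'.le).1 (mul_left_cancel₀ hR.ne' h)
    have h3 : s / R ^ 2 ≠ 0 := by positivity
    exact mul_left_cancel₀ h3 (add_left_cancel h2)
  rw [← himg, lintegral_image_eq_lintegral_abs_deriv_mul measurableSet_Ioi hder hinj]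
  refine setLIntegral_congr_fun measurableSet_Ioi fun u hu => ?_
  have : 0 < speed R s u := mul_pos hR (Real.sqrt_pos.2 ((one_add_pos_iff hR hs).2 hu))
  rw [abs_of_pos (by positivity)]

open Classical in
/-- The density of `dv` with respect to `s du dω`. -/
noncomputable def jac (d : ℕ) (R s u : ℝ) : ℝ :=
  if -(R ^ 2 / s) ≤ u then speed R s u ^ (d - 2) / (2 * R ^ (d - 1)) else 0

theorem jac_nonneg {d : ℕ} {R s : ℝ} (hR : 0 < R) (u : ℝ) : 0 ≤ jac d R s u := by
  unfold jac speed
  split_ifs <;> positivity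

theorem measurable_speed (R s : ℝ) : Measurable (speed R s) := by
  unfold speed; fun_prop

theorem measurable_jac (d : ℕ) (R s : ℝ) : Measurable (jac d R s) := by
  unfold jac
  refine Measurable.ite measurableSet_Ici ?_ measurable_const
  exact ((measurable_speed R s).pow_const _).div_const _

instance (d : ℕ) (R : ℝ) : IsFiniteMeasure (sphereMeasure d R) := by
  unfold sphereMeasure
  have : IsFiniteMeasure (Measure.map (fun σ : Metric.sphere (0 : Sp d) 1 => R • (σ : Sp d))
    (volume : Measure (Sp d)).toSphere) := Measure.isFiniteMeasure_map _ _
  exact Measure.smul_finite _ ENNReal.ofReal_ne_top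

theorem ae_sphereMeasure_norm {d : ℕ} {R : ℝ} (hR : 0 < R) :
    ∀ᵐ ω ∂(sphereMeasure d R), ‖ω‖ = R := by
  unfold sphereMeasure
  refine Measure.ae_smul_measure ?_ _
  rw [ae_map_iff (by fun_prop) (measurableSet_eq_fun (by fun_prop) (by fun_prop))]
  refine Eventually.of_forall fun σ => ?_
  have : ‖(σ : Sp d)‖ = 1 := by simp
  rw [norm_smul, this, Real.norm_of_nonneg hR.le, mul_one]

instance : SFinite timeMeasure := by unfold timeMeasure; infer_instance
instance : SigmaFinite timeMeasure := by unfold timeMeasure; infer_instance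
instance (d : ℕ) : SigmaFinite (timeSpaceMeasure d) := by unfold timeSpaceMeasure; infer_instance
instance (d : ℕ) (R : ℝ) : SigmaFinite (energySphereMeasure d R) := by
  unfold energySphereMeasure; infer_instance
instance (d : ℕ) (R : ℝ) : SigmaFinite (phaseMeasure d R) := by
  unfold phaseMeasure; infer_instance

theorem measurable_dilVelocity {d : ℕ} (R τ ε : ℝ) :
    Measurable fun q : ℝ × Sp d => dilVelocity R τ ε q.1 q.2 := by
  unfold dilVelocity; fun_prop

/-- The velocity distribution `dv` in the energy and direction variables. -/
noncomputable def dilMeasure (d : ℕ) (R s : ℝ) : Measure (ℝ × Sp d) :=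
  (energySphereMeasure d R).withDensity fun q => ENNReal.ofReal (s * jac d R s q.1)

/-- In polar coordinates `r^(d-1) dr = (s/2) r^(d-2) du`, while passing from the unit sphere to
`∂B(0, R)` costs a factor `R^(d-1)`; together they give `s * jac`. -/
theorem map_dilVelocity {d : ℕ} (hd : 2 ≤ d) {R τ ε : ℝ} (hR : 0 < R) (hε : 0 < ε) :
    Measure.map (fun q : ℝ × Sp d => dilVelocity R τ ε q.1 q.2) (dilMeasure d R (ε ^ τ)) =
      volume := by
  have hs : 0 < ε ^ τ := Real.rpow_pos_of_pos hε τ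
  set s := ε ^ τ with hsdef
  refine Measure.ext_of_lintegral _ fun F hF => ?_
  have hmv := measurable_dilVelocity (d := d) R τ ε
  have hj : Measurable fun q : ℝ × Sp d => ENNReal.ofReal (s * jac d R s q.1) :=
    (((measurable_jac d R s).const_mul s).comp measurable_fst).ennreal_ofReal
  have hFv : Measurable fun q : ℝ × Sp d => F (dilVelocity R τ ε q.1 q.2) := hF.comp hmv
  have hFs : Measurable fun q : ℝ × Sp d =>
      ENNReal.ofReal (s * jac d R s q.1) * F (dilVelocity R τ ε q.1 q.2) :=
    hj.mul hFv
  rw [lintegral_map hF hmv, dilMeasure, lintegral_withDensity_eq_lintegral_mul _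
    hj hFv, lintegral_eq_lintegral_sphere_Ioi (by omega) hF]
  have hstep : ∀ σ : Metric.sphere (0 : Sp d) 1,
      ∫⁻ r in Ioi (0 : ℝ), ENNReal.ofReal (r ^ (d - 1)) * F (r • (σ : Sp d)) =
      ∫⁻ u, ENNReal.ofReal (R ^ (d - 1)) *
        (ENNReal.ofReal (s * jac d R s u) * F (dilVelocity R τ ε u (R • (σ : Sp d)))) := by
    intro σ
    rw [lintegral_Ioi_eq_lintegral_speed hR hs, ← lintegral_indicator measurableSet_Ioi]
    -- The support of `jac` contains the endpoint, which corresponds to `v = 0` and is left out by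
    -- the substitution.
    have hne : ∀ᵐ u : ℝ, u ≠ -(R ^ 2 / s) := by
      simp [ae_iff]
    refine lintegral_congr_ae (hne.mono fun u hu => ?_)
    simp only [indicator]
    split_ifs with h
    · have hpos : 0 < speed R s u :=
        mul_pos hR (Real.sqrt_pos.2 ((one_add_pos_iff hR hs).2 h))
      rw [jac, if_pos (le_of_lt h), ← mul_assoc, ← mul_assoc, ← ENNReal.ofReal_mul (by positivity),
        ← ENNReal.ofReal_mul (by positivity)]
      congr 2
      -- With `d = k + 2` the truncated subtractions `d - 1` and `d - 2` become honest.
      · obtain ⟨k, rfl⟩ := Nat.exists_eq_add_of_le' hd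
        simp only [show k + 2 - 1 = k + 1 by omega, show k + 2 - 2 = k by omega]
        rw [pow_succ]
        field_simp
      · rw [dilVelocity, smul_smul, speed, mul_comm]
    · have : ¬ -(R ^ 2 / s) ≤ u := fun h' => h (lt_of_le_of_ne h' (Ne.symm hu))
      rw [jac, if_neg this]
      simp
  simp_rw [hstep, Pi.mul_apply]
  rw [energySphereMeasure, sphereMeasure]
  have hmap : Measurable fun σ : Metric.sphere (0 : Sp d) 1 => R • (σ : Sp d) := by fun_prop
  rw [lintegral_lintegral_swap, lintegral_prod _ hFs.aemeasurable]
  · refine lintegral_congr fun u => ?_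
    rw [lintegral_const_mul _ (by
        exact (measurable_const.mul (hF.comp (hmv.comp (measurable_const.prodMk hmap))))),
      lintegral_smul_measure, lintegral_map (f := fun a : Sp d => ENNReal.ofReal (s * jac d R s u) *
        F (dilVelocity R τ ε u a)) (hFs.comp (measurable_const.prodMk measurable_id)) hmap]
    rfl
  · exact (measurable_const.mul (hFs.comp
      (measurable_snd.prodMk (hmap.comp measurable_fst)))).aemeasurable

/-! ### Change of variables in the velocity, the other variables being kept. -/

section Transfer

variable {X : Type*} [MeasurableSpace X] {d : ℕ} {R τ ε : ℝ}

/-- The velocity of a point of `X × ℝ × ∂B(0, R)`, the first component being kept. -/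
noncomputable def dilMap (R τ ε : ℝ) (p : X × (ℝ × Sp d)) : X × Sp d :=
  (p.1, dilVelocity R τ ε p.2.1 p.2.2)

theorem measurable_dilMap : Measurable (dilMap (X := X) (d := d) R τ ε) :=
  measurable_fst.prodMk ((measurable_dilVelocity R τ ε).comp measurable_snd)

theorem measurable_dilDensity : Measurable fun p : X × (ℝ × Sp d) =>
    ENNReal.ofReal (ε ^ τ * jac d R (ε ^ τ) p.2.1) :=
  (((measurable_jac d R _).const_mul _).comp (measurable_fst.comp measurable_snd)).ennreal_ofReal

theorem map_dilMap (μ : Measure X) [SFinite μ] (hd : 2 ≤ d) (hR : 0 < R) (hε : 0 < ε) :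
    Measure.map (dilMap R τ ε) ((μ.prod (energySphereMeasure d R)).withDensity
      fun p => ENNReal.ofReal (ε ^ τ * jac d R (ε ^ τ) p.2.1)) = μ.prod volume := by
  have h := map_dilVelocity (τ := τ) hd hR hε
  have hg : Measurable fun q : ℝ × Sp d => ENNReal.ofReal (ε ^ τ * jac d R (ε ^ τ) q.1) :=
    (((measurable_jac d R _).const_mul _).comp measurable_fst).ennreal_ofReal
  have : SFinite (dilMeasure d R (ε ^ τ)) := by unfold dilMeasure; infer_instance
  have hd' : (μ.prod (energySphereMeasure d R)).withDensity
      (fun p => ENNReal.ofReal (ε ^ τ * jac d R (ε ^ τ) p.2.1)) =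
      μ.prod (dilMeasure d R (ε ^ τ)) := (prod_withDensity_right hg).symm
  rw [hd', ← h]
  conv_rhs => rw [← Measure.map_id (μ := μ)]
  rw [Measure.map_prod_map _ _ measurable_id (measurable_dilVelocity R τ ε)]
  rfl

/-- Velocity-null sets pull back to null sets only where the density is positive: all `u` below the
cutoff are sent to `v = 0`, so nothing can be said there. -/
theorem ae_dilMap {μ : Measure X} [SFinite μ] (hd : 2 ≤ d) (hR : 0 < R) (hε : 0 < ε)
    {P : X × Sp d → Prop} (h : ∀ᵐ q ∂(μ.prod volume), P q) :
    ∀ᵐ p ∂(μ.prod (energySphereMeasure d R)), jac d R (ε ^ τ) p.2.1 ≠ 0 → P (dilMap R τ ε p) := by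
  rw [← map_dilMap (τ := τ) μ hd hR hε] at h
  have h1 := ae_of_ae_map measurable_dilMap.aemeasurable h
  rw [ae_withDensity_iff measurable_dilDensity] at h1
  filter_upwards [h1] with p hp hj
  have h0 : 0 < jac d R (ε ^ τ) p.2.1 := lt_of_le_of_ne (jac_nonneg hR _) (Ne.symm hj)
  exact hp (ENNReal.ofReal_pos.2 (mul_pos (Real.rpow_pos_of_pos hε τ) h0)).ne'

/-- The factor `jac` removes the region where `F ∘ dilMap` depends on more than the
almost-everywhere class of `F`. -/
theorem aemeasurable_jac_mul_dilMap {μ : Measure X} [SFinite μ] (hd : 2 ≤ d) (hR : 0 < R)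
    (hε : 0 < ε) {F : X × Sp d → ℝ} (hF : AEMeasurable F (μ.prod volume)) :
    AEMeasurable (fun p : X × (ℝ × Sp d) => jac d R (ε ^ τ) p.2.1 * F (dilMap R τ ε p))
      (μ.prod (energySphereMeasure d R)) := by
  obtain ⟨F', hF', h⟩ := hF
  refine ⟨fun p => jac d R (ε ^ τ) p.2.1 * F' (dilMap R τ ε p),
    ((measurable_jac d R _).comp (measurable_fst.comp measurable_snd)).mul
      (hF'.comp measurable_dilMap), ?_⟩
  filter_upwards [ae_dilMap (τ := τ) hd hR hε h] with p hp
  by_cases h0 : jac d R (ε ^ τ) p.2.1 = 0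
  · simp [h0]
  · simp only [hp h0]

theorem lintegral_dilMap {μ : Measure X} [SFinite μ] (hd : 2 ≤ d) (hR : 0 < R)
    (hε : 0 < ε) {F : X × Sp d → ENNReal} (hF : AEMeasurable F (μ.prod volume)) :
    ∫⁻ p, ENNReal.ofReal (ε ^ τ * jac d R (ε ^ τ) p.2.1) * F (dilMap R τ ε p)
      ∂(μ.prod (energySphereMeasure d R)) = ∫⁻ q, F q ∂(μ.prod volume) := by
  have hmap := map_dilMap (τ := τ) μ hd hR hε
  rw [← hmap] at hF
  rw [← hmap, lintegral_map' hF measurable_dilMap.aemeasurable]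
  exact (lintegral_withDensity_eq_lintegral_mul₀' measurable_dilDensity.aemeasurable
    (hF.comp_measurable measurable_dilMap)).symm

theorem integral_dilMap {μ : Measure X} [SFinite μ] (hd : 2 ≤ d) (hR : 0 < R)
    (hε : 0 < ε) {F : X × Sp d → ℝ} (hF : AEStronglyMeasurable F (μ.prod volume)) :
    ∫ p, ε ^ τ * jac d R (ε ^ τ) p.2.1 * F (dilMap R τ ε p)
      ∂(μ.prod (energySphereMeasure d R)) = ∫ q, F q ∂(μ.prod volume) := by
  have hmap := map_dilMap (τ := τ) μ hd hR hε
  rw [← hmap] at hF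
  have hs : 0 < ε ^ τ := Real.rpow_pos_of_pos hε τ
  rw [← hmap, integral_map measurable_dilMap.aemeasurable hF]
  rw [integral_withDensity_eq_integral_toReal_smul measurable_dilDensity
    (Eventually.of_forall fun _ => ENNReal.ofReal_lt_top)]
  refine integral_congr_ae (Eventually.of_forall fun p => ?_)
  simp [ENNReal.toReal_ofReal (mul_nonneg hs.le (jac_nonneg (d := d) hR p.2.1))]

end Transfer

/-! ### Slices at fixed time -/

theorem ae_slice_timeSpace {d : ℕ} {Y : Type*} [MeasurableSpace Y] {ν : Measure Y} [SFinite ν]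
    {P : (ℝ × Sp d) × Y → Prop} (h : ∀ᵐ p ∂((timeSpaceMeasure d).prod ν), P p) :
    ∀ᵐ t ∂timeMeasure, ∀ᵐ z ∂((volume : Measure (Sp d)).prod ν), P ((t, z.1), z.2) := by
  have hmp := (measurePreserving_prodAssoc timeMeasure (volume : Measure (Sp d)) ν).symm
  exact Measure.ae_ae_of_ae_prod (hmp.quasiMeasurePreserving.ae h)

theorem aemeasurable_slice_timeSpace {d : ℕ} {Y : Type*} [MeasurableSpace Y] {ν : Measure Y}
    [SFinite ν] {F : (ℝ × Sp d) × Y → ℝ} (h : AEMeasurable F ((timeSpaceMeasure d).prod ν)) :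
    ∀ᵐ t ∂timeMeasure, AEMeasurable (fun z : Sp d × Y => F ((t, z.1), z.2))
      ((volume : Measure (Sp d)).prod ν) := by
  obtain ⟨F', hF', h⟩ := h
  filter_upwards [ae_slice_timeSpace h] with t ht
  refine ⟨fun z => F' ((t, z.1), z.2), hF'.comp (by fun_prop), ht⟩

theorem lintegral_slice_timeSpace {d : ℕ} {Y : Type*} [MeasurableSpace Y] {ν : Measure Y}
    [SFinite ν] {F : (ℝ × Sp d) × Y → ENNReal} (h : AEMeasurable F ((timeSpaceMeasure d).prod ν)) :
    ∫⁻ p, F p ∂((timeSpaceMeasure d).prod ν) =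
      ∫⁻ t, ∫⁻ z, F ((t, z.1), z.2) ∂((volume : Measure (Sp d)).prod ν) ∂timeMeasure := by
  have hmp := (measurePreserving_prodAssoc timeMeasure (volume : Measure (Sp d)) ν).symm
  have h' : AEMeasurable F (Measure.map MeasurableEquiv.prodAssoc.symm
      (timeMeasure.prod ((volume : Measure (Sp d)).prod ν))) := by rw [hmp.map_eq]; exact h
  rw [timeSpaceMeasure, ← hmp.map_eq, lintegral_map' h' hmp.measurable.aemeasurable]
  exact lintegral_prod _ (h'.comp_measurable hmp.measurable)

/-! ### Bounds on the Jacobian -/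

/-- Any polynomial bound uniform in `s` suffices, in view of `halfVariance_le`; the exponent `d` is
not optimal. -/
theorem exists_jac_le (d : ℕ) {R : ℝ} (hR : 0 < R) (s₀ : ℝ) :
    ∃ J > 0, ∀ s, 0 < s → s ≤ s₀ → ∀ u, jac d R s u ≤ J * (1 + |u|) ^ d := by
  refine ⟨(R * (1 + |s₀| / R ^ 2)) ^ (d - 2) / (2 * R ^ (d - 1)), by positivity, ?_⟩
  intro s hs hs0 u
  have hu := abs_nonneg u
  have h0 : s ≤ |s₀| := hs0.trans (le_abs_self _)
  have hspeed : speed R s u ≤ R * (1 + |s₀| / R ^ 2) * (1 + |u|) := by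
    have h1 : 1 + s / R ^ 2 * u ≤ 1 + |s₀| / R ^ 2 * |u| := by
      have h1 : s / R ^ 2 * u ≤ s / R ^ 2 * |u| := by
        gcongr
        exact le_abs_self u
      have h2 : s / R ^ 2 * |u| ≤ |s₀| / R ^ 2 * |u| := by gcongr
      linarith
    have h2 : 1 + |s₀| / R ^ 2 * |u| ≤ (1 + |s₀| / R ^ 2) * (1 + |u|) := by
      have : 0 ≤ |s₀| / R ^ 2 := by positivity
      nlinarith
    -- `√(1 + y) ≤ 1 + y` for `y ≥ 0`.
    have h3 : Real.sqrt (1 + s / R ^ 2 * u) ≤ 1 + |s₀| / R ^ 2 * |u| := by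
      have : 0 ≤ |s₀| / R ^ 2 * |u| := by positivity
      refine (Real.sqrt_le_sqrt h1).trans ?_
      rw [Real.sqrt_le_left (by positivity)]
      nlinarith
    rw [speed, mul_assoc]
    gcongr
    exact h3.trans h2
  unfold jac
  split_ifs
  · have hnn : 0 ≤ speed R s u := by unfold speed; positivity
    calc speed R s u ^ (d - 2) / (2 * R ^ (d - 1))
        ≤ (R * (1 + |s₀| / R ^ 2) * (1 + |u|)) ^ (d - 2) / (2 * R ^ (d - 1)) := by gcongr
      _ = (R * (1 + |s₀| / R ^ 2)) ^ (d - 2) / (2 * R ^ (d - 1)) * (1 + |u|) ^ (d - 2) := by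
          rw [mul_pow]; ring
      _ ≤ _ := by
          gcongr
          · linarith
          · omega
  · positivity

/-- The limit `R^(d-2) / (2 R^(d-1))` is the source of the factor `R` in the constant of the `cosh`
bound. -/
theorem tendsto_jac {d : ℕ} (hd : 2 ≤ d) {R : ℝ} (hR : 0 < R) {s : ℕ → ℝ} (hs : ∀ n, 0 < s n)
    (hs0 : Tendsto s atTop (𝓝 0)) (u : ℝ) :
    Tendsto (fun n => jac d R (s n) u) atTop (𝓝 (1 / (2 * R))) := by
  have hlim : Tendsto (fun n => 1 + s n / R ^ 2 * u) atTop (𝓝 1) := by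
    have : Tendsto (fun n => 1 + s n / R ^ 2 * u) atTop (𝓝 (1 + 0 / R ^ 2 * u)) :=
      ((hs0.div_const _).mul_const u).const_add 1
    simpa using this
  have hev : ∀ᶠ n in atTop, jac d R (s n) u = speed R (s n) u ^ (d - 2) / (2 * R ^ (d - 1)) := by
    filter_upwards [hlim.eventually (lt_mem_nhds one_pos)] with n hn
    rw [jac, if_pos ((one_add_pos_iff hR (hs n)).1 hn).le]
  have hsp : Tendsto (fun n => speed R (s n) u) atTop (𝓝 R) := by
    have := (hlim.sqrt).const_mul R
    simpa [speed] using this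
  refine Tendsto.congr' (EventuallyEq.symm hev) ?_
  have h := (hsp.pow (d - 2)).div_const (2 * R ^ (d - 1))
  convert h using 2
  obtain ⟨k, rfl⟩ := Nat.exists_eq_add_of_le' hd
  simp only [show k + 2 - 1 = k + 1 by omega, show k + 2 - 2 = k by omega]
  rw [pow_succ]
  field_simp

theorem tendsto_dilVelocity {d : ℕ} (R : ℝ) {τ : ℝ} {ε : ℕ → ℝ}
    (hs0 : Tendsto (fun n => ε n ^ τ) atTop (𝓝 0)) (u : ℝ) (ω : Sp d) :
    Tendsto (fun n => dilVelocity R τ (ε n) u ω) atTop (𝓝 ω) := by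
  have hlim : Tendsto (fun n => 1 + ε n ^ τ / R ^ 2 * u) atTop (𝓝 (1 + 0 / R ^ 2 * u)) :=
    ((hs0.div_const _).mul_const u).const_add 1
  have := (hlim.sqrt).smul_const ω
  simpa [dilVelocity] using this

/-! ### The entropy dominates linear functionals of the dilated fluctuations -/

/-- A function `G` that is controlled by an energy density `E` through a family of linear
functionals: the only information on the dilated fluctuations used in the sequel. -/
structure EntropyDominated (d : ℕ) (δ R C η : ℝ) (j : ℝ → ℝ) (G E : Phase d → ℝ) : Prop where
  aemeasurable : AEMeasurable G (phaseMeasure d R)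
  aemeasurable_density : AEMeasurable E (phaseMeasure d R)
  lintegral_le : ∀ᵐ t ∂timeMeasure, ∫⁻ z : Sp d × (ℝ × Sp d), ENNReal.ofReal (E ((t, z.1), z.2))
    ∂((volume : Measure (Sp d)).prod (energySphereMeasure d R)) ≤ ENNReal.ofReal C
  mul_le : ∀ᵐ p ∂(phaseMeasure d R), ∀ l : ℝ, δ * G p * l ≤
    E p + j p.2.1 * l ^ 2 * Real.exp (η * |l|) * halfVariance p.2.1

/-- The rescaled entropy density in the dilated variables. -/
noncomputable def entropyDensity {d : ℕ} (δ R τ : ℝ) (f : ℝ → ℝ → Sp d → Sp d → ℝ) (ε : ℝ)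
    (p : Phase d) : ℝ :=
  ((ε ^ (1 - τ)) ^ 2)⁻¹ * (jac d R (ε ^ τ) p.2.1 *
    entropyFn (δ * f ε p.1.1 p.1.2 (dilVelocity R τ ε p.2.1 p.2.2))
      (δ * fermiDirac δ R τ ε (dilVelocity R τ ε p.2.1 p.2.2)))

theorem norm_dilVelocity {d : ℕ} {R : ℝ} (τ ε u : ℝ) {ω : Sp d} (hω : ‖ω‖ = R) :
    ‖dilVelocity R τ ε u ω‖ = speed R (ε ^ τ) u := by
  rw [dilVelocity, norm_smul, hω, Real.norm_of_nonneg (Real.sqrt_nonneg _), mul_comm]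
  rfl

theorem dilFluctuation_eq {d : ℕ} {R : ℝ} (δ τ : ℝ) (f : ℝ → ℝ → Sp d → Sp d → ℝ) (ε : ℝ)
    {p : Phase d} (hω : ‖p.2.2‖ = R) :
    dilFluctuation δ R τ f ε p = ε ^ τ * (jac d R (ε ^ τ) p.2.1 *
      fluctuation δ R τ f ε p.1.1 p.1.2 (dilVelocity R τ ε p.2.1 p.2.2)) := by
  unfold dilFluctuation jac
  rw [norm_dilVelocity _ _ _ hω]
  split_ifs
  · ring
  · simp

theorem fermiDirac_dilVelocity {d : ℕ} {δ R τ ε u : ℝ} (hδ : 0 < δ) (hR : 0 < R) (hε : 0 < ε)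
    (hu : -(R ^ 2 / ε ^ τ) ≤ u) {ω : Sp d} (hω : ‖ω‖ = R) :
    δ * fermiDirac δ R τ ε (dilVelocity R τ ε u ω) = (1 + Real.exp u)⁻¹ := by
  have hs : 0 < ε ^ τ := Real.rpow_pos_of_pos hε τ
  have h0 : 0 ≤ 1 + ε ^ τ / R ^ 2 * u := by
    have : 1 + ε ^ τ / R ^ 2 * u = ε ^ τ / R ^ 2 * (u - -(R ^ 2 / ε ^ τ)) := by field_simp; ring
    rw [this]
    have := sub_nonneg.2 hu
    positivity
  have : (‖dilVelocity R τ ε u ω‖ ^ 2 - R ^ 2) / ε ^ τ = u := by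
    rw [norm_dilVelocity _ _ _ hω, speed, mul_pow, Real.sq_sqrt h0]
    field_simp
    ring
  rw [fermiDirac, this, ← mul_assoc, mul_one_div_cancel hδ.ne', one_mul]

theorem ae_prod_energySphere_norm {X : Type*} [MeasurableSpace X] (μ : Measure X) [SFinite μ]
    {d : ℕ} {R : ℝ} (hR : 0 < R) :
    ∀ᵐ p : X × (ℝ × Sp d) ∂(μ.prod (energySphereMeasure d R)), ‖p.2.2‖ = R := by
  have h1 : ∀ᵐ q : ℝ × Sp d ∂(energySphereMeasure d R), ‖q.2‖ = R :=
    Measure.quasiMeasurePreserving_snd.ae (ae_sphereMeasure_norm hR)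
  exact Measure.quasiMeasurePreserving_snd.ae h1

/-- Young's inequality at `η l` with `η = ε^(1-τ)`, multiplied by `jac / η²`. The left side becomes
`δ g̃ l` because `ε^τ / ε = 1 / η`. -/
theorem IsEntropyBoundedFamily.dominated {d : ℕ} (hd : 2 ≤ d) {δ R τ Cin : ℝ} (hδ : 0 < δ)
    (hR : 0 < R) {f : ℝ → ℝ → Sp d → Sp d → ℝ} (hf : IsEntropyBoundedFamily d δ R τ τ Cin f)
    {ε : ℝ} (hε : 0 < ε) :
    EntropyDominated d δ R Cin (ε ^ (1 - τ)) (jac d R (ε ^ τ)) (dilFluctuation δ R τ f ε)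
      (entropyDensity δ R τ f ε) := by
  have hs : 0 < ε ^ τ := Real.rpow_pos_of_pos hε τ
  have hη : 0 < ε ^ (1 - τ) := Real.rpow_pos_of_pos hε _
  have hηs : ε ^ τ / ε = (ε ^ (1 - τ))⁻¹ := by
    rw [Real.rpow_sub hε, Real.rpow_one, inv_div]
  have hM : Measurable fun v : Sp d => fermiDirac δ R τ ε v := by unfold fermiDirac; fun_prop
  have hent : Measurable fun q : ℝ × ℝ => entropyFn q.1 q.2 := by unfold entropyFn; fun_prop
  have hnorm := ae_prod_energySphere_norm (timeSpaceMeasure d) (d := d) hR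
  have hEm : AEMeasurable (fun q : (ℝ × Sp d) × Sp d =>
      entropyFn (δ * f ε q.1.1 q.1.2 q.2) (δ * fermiDirac δ R τ ε q.2))
      ((timeSpaceMeasure d).prod volume) :=
    hent.comp_aemeasurable (((hf.aemeasurable ε hε).const_mul δ).prodMk
      (((hM.comp measurable_snd).const_mul δ).aemeasurable))
  refine ⟨?_, ?_, ?_, ?_⟩
  · have h := aemeasurable_jac_mul_dilMap (τ := τ) (μ := timeSpaceMeasure d) hd hR hε
      (F := fun q => fluctuation δ R τ f ε q.1.1 q.1.2 q.2)
      (((hf.aemeasurable ε hε).sub (hM.comp measurable_snd).aemeasurable).div_const ε)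
    refine (h.const_mul (ε ^ τ)).congr ?_
    filter_upwards [hnorm] with p hp
    exact (dilFluctuation_eq δ τ f ε hp).symm
  · exact (aemeasurable_jac_mul_dilMap (τ := τ) (μ := timeSpaceMeasure d) hd hR hε hEm).const_mul _
  · filter_upwards [hf.entropy ε hε, aemeasurable_slice_timeSpace hEm] with t ht hmeas
    refine le_of_eq_of_le ?_ ht
    have h := lintegral_dilMap (τ := τ) (μ := (volume : Measure (Sp d))) hd hR hε
      hmeas.ennreal_ofReal
    rw [relEntropy, ← h, ← lintegral_const_mul'' _]
    · refine lintegral_congr fun z => ?_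
      have hj := jac_nonneg (d := d) (s := ε ^ τ) hR z.2.1
      rw [← ENNReal.ofReal_mul (by positivity), ← ENNReal.ofReal_mul (by positivity)]
      congr 1
      simp only [entropyDensity, dilMap]
      -- The scaling identity `η⁻² = ε^(-(2-τ)) ε^τ`: one factor normalizes the entropy (as `γ =
      -- τ`), the other belongs to the change of variables.
      have : ((ε ^ (1 - τ)) ^ 2)⁻¹ = 1 / ε ^ (2 - τ) * ε ^ τ := by
        rw [← Real.rpow_natCast, ← Real.rpow_mul hε.le, ← Real.rpow_neg hε.le, one_div,
          ← Real.rpow_neg hε.le, ← Real.rpow_add hε]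
        congr 1; push_cast; ring
      rw [this]
      ring
    · have h2 := aemeasurable_jac_mul_dilMap (τ := τ) (μ := (volume : Measure (Sp d))) hd hR hε hmeas
      refine (h2.const_mul (ε ^ τ)).ennreal_ofReal.congr (Eventually.of_forall fun z => ?_)
      have hj := jac_nonneg (d := d) (s := ε ^ τ) hR z.2.1
      simp only
      rw [← mul_assoc, ENNReal.ofReal_mul (by positivity)]
  · have hb := ae_dilMap (τ := τ) hd hR hε (hf.bounds ε hε)
    filter_upwards [hnorm, hb] with p hp hbp l
    rw [dilFluctuation_eq δ τ f ε hp, entropyDensity]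
    by_cases hj : jac d R (ε ^ τ) p.2.1 = 0
    · simp [hj]
    have hjpos : 0 < jac d R (ε ^ τ) p.2.1 := lt_of_le_of_ne (jac_nonneg hR _) (Ne.symm hj)
    have hu : -(R ^ 2 / ε ^ τ) ≤ p.2.1 := by
      by_contra h
      exact hj (by rw [jac, if_neg h])
    obtain ⟨hf0, hf1⟩ := hbp hj
    simp only [dilMap] at hf0 hf1
    have hM' := fermiDirac_dilVelocity (τ := τ) hδ hR hε hu hp
    rw [hM']
    have hz1 : δ * f ε p.1.1 p.1.2 (dilVelocity R τ ε p.2.1 p.2.2) ≤ 1 := by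
      calc _ ≤ δ * δ⁻¹ := by gcongr
        _ = 1 := mul_inv_cancel₀ hδ.ne'
    have hY := mul_sub_le_entropyFn_add_sq (mul_nonneg hδ.le hf0) hz1 p.2.1 (ε ^ (1 - τ) * l)
    rw [abs_mul, abs_of_pos hη] at hY
    have hmul := mul_le_mul_of_nonneg_left hY
      (show 0 ≤ ((ε ^ (1 - τ)) ^ 2)⁻¹ * jac d R (ε ^ τ) p.2.1 by positivity)
    have hL : δ * (ε ^ τ * (jac d R (ε ^ τ) p.2.1 *
        fluctuation δ R τ f ε p.1.1 p.1.2 (dilVelocity R τ ε p.2.1 p.2.2))) * l =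
        ((ε ^ (1 - τ)) ^ 2)⁻¹ * jac d R (ε ^ τ) p.2.1 * (ε ^ (1 - τ) * l *
          (δ * f ε p.1.1 p.1.2 (dilVelocity R τ ε p.2.1 p.2.2) - (1 + Real.exp p.2.1)⁻¹)) := by
      rw [← hM', fluctuation]
      have : ε ^ τ = (ε ^ (1 - τ))⁻¹ * ε := by rw [← hηs]; field_simp
      rw [this]
      field_simp
    rw [hL]
    refine hmul.trans_eq ?_
    field_simp

/-! ### Integrals of polynomially and exponentially weighted functions -/

theorem exists_pow_mul_exp_neg_le (n : ℕ) {c : ℝ} (hc : 0 < c) :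
    ∃ C > 0, ∀ u : ℝ, (1 + |u|) ^ n * Real.exp (-(c * |u|)) ≤ C := by
  refine ⟨n.factorial / c ^ n * Real.exp c, by positivity, fun u => ?_⟩
  have h := Real.pow_div_factorial_le_exp (c * (1 + |u|)) (by positivity) n
  rw [div_le_iff₀ (by positivity), mul_pow] at h
  have h2 : (1 + |u|) ^ n ≤ n.factorial / c ^ n * Real.exp (c * (1 + |u|)) := by
    rw [div_mul_eq_mul_div, le_div_iff₀ (by positivity)]
    linarith
  calc (1 + |u|) ^ n * Real.exp (-(c * |u|))
      ≤ n.factorial / c ^ n * Real.exp (c * (1 + |u|)) * Real.exp (-(c * |u|)) := by gcongr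
    _ = _ := by rw [mul_assoc, ← Real.exp_add]; ring_nf

theorem integrable_pow_mul_exp_neg (n : ℕ) {c : ℝ} (hc : 0 < c) :
    Integrable fun u : ℝ => (1 + |u|) ^ n * Real.exp (-(c * |u|)) := by
  obtain ⟨C, hC, h⟩ := exists_pow_mul_exp_neg_le (n + 2) hc
  have hi : Integrable fun u : ℝ => C * (1 + ‖u‖) ^ (-(2 : ℝ)) :=
    (integrable_one_add_norm (by simp)).const_mul C
  refine hi.mono' (by fun_prop) (Eventually.of_forall fun u => ?_)
  have hu : 0 < 1 + |u| := by positivity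
  rw [Real.norm_of_nonneg (by positivity), Real.norm_eq_abs, Real.rpow_neg hu.le, Real.rpow_two,
    ← div_eq_mul_inv, le_div_iff₀ (by positivity)]
  calc _ = (1 + |u|) ^ (n + 2) * Real.exp (-(c * |u|)) := by ring
    _ ≤ C := h u

theorem lintegral_energy {X : Type*} [MeasurableSpace X] (μ : Measure X) [SFinite μ] {d : ℕ}
    {R : ℝ} {Q : ℝ → ENNReal} (hQ : Measurable Q) :
    ∫⁻ p : X × (ℝ × Sp d), Q p.2.1 ∂(μ.prod (energySphereMeasure d R)) =
      (∫⁻ u, Q u) * sphereMeasure d R univ * μ univ := by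
  rw [lintegral_prod _ (by fun_prop)]
  simp only [lintegral_const]
  rw [energySphereMeasure, lintegral_prod _ (by fun_prop)]
  simp only [lintegral_const]
  rw [lintegral_mul_const _ hQ]

theorem restrict_prod_univ {X Y : Type*} [MeasurableSpace X] [MeasurableSpace Y] (μ : Measure X)
    (ν : Measure Y) [SFinite μ] [SFinite ν] (K : Set X) :
    (μ.prod ν).restrict (K ×ˢ univ) = (μ.restrict K).prod ν := by
  rw [← Measure.prod_restrict, Measure.restrict_univ]

instance (d : ℕ) : IsFiniteMeasureOnCompacts (timeSpaceMeasure d) := by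
  unfold timeSpaceMeasure timeMeasure; infer_instance

theorem weighted_abs {d : ℕ} (G : Phase d → ℝ) (p : Phase d) :
    |weighted G p| = (1 + |p.2.1|) * |G p| := by
  rw [weighted, abs_mul, abs_of_nonneg (by positivity)]

/-! ### Estimates for a function dominated by an energy density. -/

namespace EntropyDominated

variable {d : ℕ} {δ R C η : ℝ} {j : ℝ → ℝ} {G E : Phase d → ℝ}

theorem density_nonneg (h : EntropyDominated d δ R C η j G E) :
    ∀ᵐ p ∂(phaseMeasure d R), 0 ≤ E p := by
  filter_upwards [h.mul_le] with p hp
  simpa using hp 0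

theorem abs_mul_le (h : EntropyDominated d δ R C η j G E) (hj : ∀ u, 0 ≤ j u) :
    ∀ᵐ p ∂(phaseMeasure d R), ∀ l : ℝ, 0 ≤ l → δ * |G p| * l ≤
      E p + j p.2.1 * l ^ 2 * Real.exp (η * l) * (Real.exp (-|p.2.1|) / 2) := by
  filter_upwards [h.mul_le] with p hp l hl
  have hq : j p.2.1 * l ^ 2 * Real.exp (η * l) * halfVariance p.2.1 ≤
      j p.2.1 * l ^ 2 * Real.exp (η * l) * (Real.exp (-|p.2.1|) / 2) := by
    have := hj p.2.1
    gcongr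
    exact halfVariance_le _
  rcases abs_cases (G p) with ⟨hG, -⟩ | ⟨hG, -⟩
  · have h1 := hp l
    rw [abs_of_nonneg hl] at h1
    rw [hG]
    linarith
  · have h1 := hp (-l)
    rw [abs_neg, abs_of_nonneg hl, neg_sq] at h1
    rw [hG]
    linarith

/-- The uniform bound in `L^∞(dt; L¹_loc(dx; L¹((1 + |u|) du dω)))`. -/
theorem exists_lintegral_weighted_le (d : ℕ) {δ R C η₀ J : ℝ} (hδ : 0 < δ) (hη₀ : 0 < η₀)
    (hJ : 0 ≤ J)
    {K : Set (Sp d)} (hK : IsCompact K) :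
    ∃ B : NNReal, ∀ (η : ℝ) (j : ℝ → ℝ) (G E : Phase d → ℝ), η ≤ η₀ → (∀ u, 0 ≤ j u) →
      (∀ u, j u ≤ J * (1 + |u|) ^ d) → EntropyDominated d δ R C η j G E → ∀ᵐ t ∂timeMeasure,
        ∫⁻ z in K ×ˢ (univ : Set (ℝ × Sp d)), ENNReal.ofReal |weighted G ((t, z.1), z.2)|
          ∂((volume : Measure (Sp d)).prod (energySphereMeasure d R)) ≤ (B : ENNReal) := by
  -- With this `κ`, `exp (η κ (1 + |u|))` uses up at most half of the decay `exp (-|u|)`.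
  set κ : ℝ := 1 / (2 * η₀) with hκdef
  have hκ : 0 < κ := by positivity
  let Q : ℝ → ℝ := fun u => (J * κ ^ 2 * Real.exp (1 / 2) / 2) *
    ((1 + |u|) ^ (d + 2) * Real.exp (-(1 / 2 * |u|)))
  have hQi : Integrable Q := (integrable_pow_mul_exp_neg (d + 2) (by norm_num)).const_mul _
  have hQm : Measurable Q := by fun_prop
  let T : ENNReal := ENNReal.ofReal (1 / (δ * κ)) * (ENNReal.ofReal C +
    (∫⁻ u, ENNReal.ofReal (Q u)) * sphereMeasure d R univ * (volume.restrict K) univ)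
  have hT : T ≠ ⊤ := by
    refine ENNReal.mul_ne_top ENNReal.ofReal_ne_top (ENNReal.add_ne_top.2
      ⟨ENNReal.ofReal_ne_top, ENNReal.mul_ne_top (ENNReal.mul_ne_top ?_ (measure_ne_top _ _)) ?_⟩)
    · exact ne_of_lt (lt_of_le_of_lt (lintegral_mono fun u => Real.ofReal_le_enorm _) hQi.2)
    · rw [Measure.restrict_apply_univ]
      exact hK.measure_lt_top.ne
  refine ⟨T.toNNReal, fun η j G E hη hj hjJ h => ?_⟩
  rw [ENNReal.coe_toNNReal hT]
  filter_upwards [h.lintegral_le, ae_slice_timeSpace (h.abs_mul_le hj)] with t ht hmul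
  rw [restrict_prod_univ]
  have hle : (volume.restrict K).prod (energySphereMeasure d R) ≤
      (volume : Measure (Sp d)).prod (energySphereMeasure d R) := by
    rw [← restrict_prod_univ]; exact Measure.restrict_le_self
  have hmul' := hmul.filter_mono (ae_mono hle)
  calc ∫⁻ z, ENNReal.ofReal |weighted G ((t, z.1), z.2)|
        ∂((volume.restrict K).prod (energySphereMeasure d R))
      ≤ ∫⁻ z, ENNReal.ofReal (1 / (δ * κ)) * (ENNReal.ofReal (E ((t, z.1), z.2)) +
          ENNReal.ofReal (Q z.2.1)) ∂((volume.restrict K).prod (energySphereMeasure d R)) := by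
        refine lintegral_mono_ae (hmul'.mono fun z hz => ?_)
        -- Taking `l` proportional to the weight makes the left side a multiple of `|weighted G|`.
        have h1 := hz (κ * (1 + |z.2.1|)) (by positivity)
        have h2 : j z.2.1 * (κ * (1 + |z.2.1|)) ^ 2 * Real.exp (η * (κ * (1 + |z.2.1|))) *
            (Real.exp (-|z.2.1|) / 2) ≤ Q z.2.1 := by
          have hexp : Real.exp (η * (κ * (1 + |z.2.1|))) * Real.exp (-|z.2.1|) ≤
              Real.exp (1 / 2) * Real.exp (-(1 / 2 * |z.2.1|)) := by
            rw [← Real.exp_add, ← Real.exp_add, Real.exp_le_exp]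
            have : η * κ ≤ 1 / 2 := by
              calc η * κ ≤ η₀ * κ := by gcongr
                _ = 1 / 2 := by rw [hκdef]; field_simp
            nlinarith [abs_nonneg z.2.1]
          have hj0 := hj z.2.1
          calc _ = j z.2.1 * (κ * (1 + |z.2.1|)) ^ 2 * (Real.exp (η * (κ * (1 + |z.2.1|))) *
                Real.exp (-|z.2.1|)) / 2 := by ring
            _ ≤ (J * (1 + |z.2.1|) ^ d) * (κ * (1 + |z.2.1|)) ^ 2 * (Real.exp (1 / 2) *
                Real.exp (-(1 / 2 * |z.2.1|))) / 2 := by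
                have := hjJ z.2.1
                gcongr
            _ = _ := by simp only [Q]; ring
        rw [weighted_abs]
        refine le_trans ?_ (mul_le_mul_right (ENNReal.ofReal_add_le) _)
        rw [← ENNReal.ofReal_mul (by positivity)]
        refine ENNReal.ofReal_le_ofReal ?_
        rw [div_mul_eq_mul_div, one_mul, le_div_iff₀ (by positivity)]
        simp only at h1 h2 ⊢
        linarith
    _ = ENNReal.ofReal (1 / (δ * κ)) * (∫⁻ z, ENNReal.ofReal (E ((t, z.1), z.2))
          ∂((volume.restrict K).prod (energySphereMeasure d R)) +
          ∫⁻ z, ENNReal.ofReal (Q z.2.1)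
            ∂((volume.restrict K).prod (energySphereMeasure d R))) := by
        rw [lintegral_const_mul' _ _ ENNReal.ofReal_ne_top, lintegral_add_right _ (by fun_prop)]
    _ ≤ T := by
        rw [lintegral_energy _ hQm.ennreal_ofReal]
        exact mul_le_mul' le_rfl (add_le_add ((lintegral_mono' hle le_rfl).trans ht) le_rfl)

/-- The energy density controls `G` linearly where `G` is large, with a small constant,
and quadratically elsewhere. -/
theorem exists_split (d : ℕ) {δ J : ℝ} (hδ : 0 < δ) (hJ : 0 < J) :
    ∃ D > 0, ∀ (R C η : ℝ) (j : ℝ → ℝ) (G E : Phase d → ℝ), 0 < η → Measurable j →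
      (∀ u, 0 ≤ j u) → (∀ u, j u ≤ J * (1 + |u|) ^ d) → EntropyDominated d δ R C η j G E →
      ∃ A B : Phase d → ℝ, AEMeasurable A (phaseMeasure d R) ∧ AEMeasurable B (phaseMeasure d R) ∧
        (∀ p, weighted G p = A p + B p) ∧ ∀ᵐ p ∂(phaseMeasure d R),
          A p ^ 2 * Real.exp (|p.2.1| / 8) ≤ D * E p ∧ |B p| ≤ 4 * η / δ * E p := by
  obtain ⟨D₁, hD₁, hD⟩ := exists_pow_mul_exp_neg_le (d + 2) (c := 1 / 8) (by norm_num)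
  refine ⟨4 * Real.exp 1 / δ ^ 2 * (J * D₁), by positivity, fun R C η j G E hη hjm hj hjJ h => ?_⟩
  -- At `l = (1 + |u|) / (2 η)` the quadratic term bound is exactly half of the linear term when
  -- `|G| = thr`. Above the threshold it can therefore be absorbed.
  let thr : Phase d → ℝ := fun p =>
    j p.2.1 * (1 + |p.2.1|) * Real.exp ((1 - |p.2.1|) / 2) / (2 * η * δ)
  have hu : Measurable fun p : Phase d => p.2.1 := measurable_fst.comp measurable_snd
  have hthr : Measurable thr := by
    have : Measurable fun p : Phase d => j p.2.1 := hjm.comp hu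
    fun_prop
  obtain ⟨G', hG', hGG'⟩ := h.aemeasurable
  have hw : Measurable (weighted G') := by
    unfold weighted; fun_prop
  have hww : weighted G =ᵐ[phaseMeasure d R] weighted G' :=
    hGG'.mono fun p hp => by simp only [weighted, hp]
  have hset : MeasurableSet {p | |G' p| ≤ thr p} :=
    measurableSet_le (by fun_prop) hthr
  classical
  refine ⟨fun p => if |G p| ≤ thr p then weighted G p else 0,
    fun p => if |G p| ≤ thr p then 0 else weighted G p,
    ⟨fun p => if |G' p| ≤ thr p then weighted G' p else 0, hw.ite hset measurable_const, ?_⟩,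
    ⟨fun p => if |G' p| ≤ thr p then 0 else weighted G' p, measurable_const.ite hset hw, ?_⟩,
    fun p => ?_, ?_⟩
  · filter_upwards [hGG', hww] with p hp hp'
    rw [hp, hp']
  · filter_upwards [hGG', hww] with p hp hp'
    rw [hp, hp']
  · dsimp only
    split_ifs <;> simp
  filter_upwards [h.abs_mul_le hj, h.density_nonneg] with p hp hE
  have hj0 := hj p.2.1
  have hu0 := abs_nonneg p.2.1
  have hG0 := abs_nonneg (G p)
  have hE1 : 0 ≤ 4 * η / δ * E p := by positivity
  have hE2 : 0 ≤ 4 * Real.exp 1 / δ ^ 2 * (J * D₁) * E p := by positivity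
  split_ifs with hgood
  · refine ⟨?_, by simpa using hE1⟩
    -- Where `j` vanishes the threshold is zero, which forces `G p = 0`; otherwise division by `j`
    -- is allowed.
    rcases hj0.eq_or_lt with h0 | hjpos
    · have : G p = 0 := by
        simp only [thr, ← h0] at hgood
        simpa using hgood
      simpa [weighted, this] using hE2
    set e : ℝ := Real.exp 1 with he
    have hepos : 0 < e := Real.exp_pos 1
    set x : ℝ := |p.2.1| with hx
    set c : ℝ := δ / (2 * e) with hc
    have hcpos : 0 < c := by positivity
    -- This `l` makes the linear term quadratic in `G`, with a gain `exp (x / 4)`. The threshold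
    -- ensures `η l ≤ 1`, so the exponential is at most `e`, and `c = δ / (2 e)` then makes the
    -- quadratic term at most a quarter of the linear one.
    set l : ℝ := c * |G p| * Real.exp (x / 4) / j p.2.1 with hl
    have hl0 : 0 ≤ l := by positivity
    have hηl : η * l ≤ 1 := by
      have h1 : (1 + x) ≤ 4 * Real.exp (x / 4) := by
        have := Real.add_one_le_exp (x / 4); linarith
      have h2 : η * l ≤ η * (c * thr p * Real.exp (x / 4) / j p.2.1) := by
        rw [hl]; gcongr
      have h3 : η * (c * thr p * Real.exp (x / 4) / j p.2.1) =
          (1 + x) * (Real.exp ((1 - x) / 2) * Real.exp (x / 4)) / (4 * e) := by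
        simp only [thr, hc, ← hx]; field_simp; ring
      have h4 : Real.exp ((1 - x) / 2) * Real.exp (x / 4) ≤ e * Real.exp (-(x / 4)) := by
        rw [he, ← Real.exp_add, ← Real.exp_add, Real.exp_le_exp]; linarith
      rw [h3] at h2
      refine h2.trans ?_
      rw [div_le_one (by positivity)]
      calc (1 + x) * (Real.exp ((1 - x) / 2) * Real.exp (x / 4))
          ≤ (4 * Real.exp (x / 4)) * (e * Real.exp (-(x / 4))) := by gcongr
        _ = 4 * e * (Real.exp (x / 4) * Real.exp (-(x / 4))) := by ring
        _ = 4 * e := by rw [← Real.exp_add]; simp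
    have h1 := hp l hl0
    have h2 : j p.2.1 * l ^ 2 * Real.exp (η * l) * (Real.exp (-x) / 2) ≤
        c * δ * |G p| ^ 2 * Real.exp (x / 4) / (4 * j p.2.1) := by
      have hexp : Real.exp (η * l) ≤ e := Real.exp_le_exp.2 hηl
      calc j p.2.1 * l ^ 2 * Real.exp (η * l) * (Real.exp (-x) / 2)
          ≤ j p.2.1 * l ^ 2 * e * (Real.exp (-x) / 2) := by gcongr
        _ = c * δ * |G p| ^ 2 * (Real.exp (x / 4) * Real.exp (x / 4) * Real.exp (-x)) /
            (4 * j p.2.1) := by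
            rw [hl, hc]; field_simp; rw [sq_abs]; ring
        _ ≤ _ := by
            gcongr
            rw [← Real.exp_add, ← Real.exp_add, Real.exp_le_exp]; linarith
    have h3 : δ * |G p| * l = c * δ * |G p| ^ 2 * Real.exp (x / 4) / j p.2.1 := by
      rw [hl]; field_simp
    have h4 : c * δ * |G p| ^ 2 * Real.exp (x / 4) / (4 * j p.2.1) =
        (c * δ * |G p| ^ 2 * Real.exp (x / 4) / j p.2.1) / 4 := by
      field_simp
    have h5 : 0 ≤ c * δ * |G p| ^ 2 * Real.exp (x / 4) / j p.2.1 := by positivity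
    have h6 : c * δ * |G p| ^ 2 * Real.exp (x / 4) / j p.2.1 ≤ 2 * E p := by linarith
    rw [div_le_iff₀ hjpos] at h6
    have h7 : |G p| ^ 2 * Real.exp (x / 4) ≤ 4 * e / δ ^ 2 * (E p * j p.2.1) := by
      have : |G p| ^ 2 * Real.exp (x / 4) =
          (c * δ * |G p| ^ 2 * Real.exp (x / 4)) * (2 * e / δ ^ 2) := by
        rw [hc]; field_simp
      rw [this]
      calc _ ≤ 2 * E p * j p.2.1 * (2 * e / δ ^ 2) := by gcongr
        _ = _ := by ring
    -- Half of the gain `exp (x / 4)` pays for `(1 + x)^(d+2)`, which comes from the weight and from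
    -- the bound on `j`; the other half remains.
    calc weighted G p ^ 2 * Real.exp (x / 8)
        = (1 + x) ^ 2 * Real.exp (-(1 / 8 * x)) * (|G p| ^ 2 * Real.exp (x / 4)) := by
          have : Real.exp (x / 8) = Real.exp (-(1 / 8 * x)) * Real.exp (x / 4) := by
            rw [← Real.exp_add]; ring_nf
          rw [weighted, this, sq_abs]; ring
      _ ≤ (1 + x) ^ 2 * Real.exp (-(1 / 8 * x)) *
          (4 * e / δ ^ 2 * (E p * (J * (1 + x) ^ d))) := by
          have := hjJ p.2.1
          exact mul_le_mul_of_nonneg_left (h7.trans (by gcongr)) (by positivity)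
      _ = 4 * e / δ ^ 2 * J * E p * ((1 + x) ^ (d + 2) * Real.exp (-(1 / 8 * x))) := by ring
      _ ≤ 4 * e / δ ^ 2 * J * E p * D₁ := by gcongr; exact hD _
      _ = _ := by ring
  · refine ⟨by simpa using hE2, ?_⟩
    rw [weighted_abs]
    set x : ℝ := |p.2.1| with hx
    -- Above the threshold, half of the linear term survives; the size `1 / η` of `l` produces the
    -- small constant in front of `E`.
    have h1 := hp ((1 + x) / (2 * η)) (by positivity)
    have h2 : j p.2.1 * ((1 + x) / (2 * η)) ^ 2 * Real.exp (η * ((1 + x) / (2 * η))) *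
        (Real.exp (-x) / 2) = thr p * (δ * (1 + x) / (4 * η)) := by
      have : Real.exp (η * ((1 + x) / (2 * η))) * Real.exp (-x) = Real.exp ((1 - x) / 2) := by
        rw [← Real.exp_add]; congr 1; field_simp; ring
      simp only [thr, ← hx]
      rw [← this]; field_simp; ring
    rw [h2] at h1
    have h3 : thr p * (δ * (1 + x) / (4 * η)) ≤ |G p| * (δ * (1 + x) / (4 * η)) := by
      gcongr
      exact (not_le.1 hgood).le
    have h4 : δ * |G p| * ((1 + x) / (2 * η)) = 2 * (|G p| * (δ * (1 + x) / (4 * η))) := by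
      field_simp; norm_num
    have h5 : |G p| * (δ * (1 + x) / (4 * η)) ≤ E p := by linarith
    calc (1 + x) * |G p| = 4 * η / δ * (|G p| * (δ * (1 + x) / (4 * η))) := by field_simp
      _ ≤ _ := by gcongr

end EntropyDominated

/-! ### Weak compactness in Hilbert spaces -/

section Hilbert

variable {H : Type*} [NormedAddCommGroup H] [InnerProductSpace ℝ H] [CompleteSpace H]

theorem tendsto_inner_of_tendsto_weakDual {ι : Type*} {l : Filter ι} {a : ι → H}
    {x : WeakDual ℝ H} (h : Tendsto (fun i => StrongDual.toWeakDual
      (InnerProductSpace.toDual ℝ H (a i))) l (𝓝 x)) (v : H) :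
    Tendsto (fun i => inner ℝ (a i) v) l
      (𝓝 (inner ℝ ((InnerProductSpace.toDual ℝ H).symm (WeakDual.toStrongDual x)) v)) := by
  have h1 := ((WeakDual.eval_continuous v).tendsto x).comp h
  rw [InnerProductSpace.toDual_symm_apply]
  exact h1

/-- Banach-Alaoglu in ultrafilter form, suited to compactness in the topological sense; the
sequential form that follows uses separability. -/
theorem exists_ultrafilter_tendsto_inner {ι : Type*} (V : Ultrafilter ι) {a : ι → H} {M : ℝ}
    (ha : ∀ᶠ i in (V : Filter ι), ‖a i‖ ≤ M) :
    ∃ h : H, ‖h‖ ≤ M ∧ ∀ v, Tendsto (fun i => inner ℝ (a i) v) V (𝓝 (inner ℝ h v)) := by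
  let m : ι → WeakDual ℝ H := fun i =>
    StrongDual.toWeakDual (InnerProductSpace.toDual ℝ H (a i))
  have hc := WeakDual.isCompact_closedBall (𝕜 := ℝ) (0 : StrongDual ℝ H) M
  have hmem : (V.map m : Filter (WeakDual ℝ H)) ≤
      𝓟 (WeakDual.toStrongDual ⁻¹' Metric.closedBall (0 : StrongDual ℝ H) M) := by
    rw [le_principal_iff]
    refine ha.mono fun i hi => ?_
    have : ‖InnerProductSpace.toDual ℝ H (a i)‖ ≤ M := by rwa [LinearIsometryEquiv.norm_map]
    simpa [m] using this
  obtain ⟨x, hx, hlim⟩ := hc.ultrafilter_le_nhds (V.map m) hmem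
  refine ⟨(InnerProductSpace.toDual ℝ H).symm (WeakDual.toStrongDual x), ?_,
    tendsto_inner_of_tendsto_weakDual hlim⟩
  rw [LinearIsometryEquiv.norm_map]
  simpa using hx

theorem exists_subseq_tendsto_inner [TopologicalSpace.SeparableSpace H] {a : ℕ → H} {M : ℝ}
    (ha : ∀ n, ‖a n‖ ≤ M) :
    ∃ k : ℕ → ℕ, StrictMono k ∧ ∃ h : H,
      ∀ v, Tendsto (fun n => inner ℝ (a (k n)) v) atTop (𝓝 (inner ℝ h v)) := by
  have hc := WeakDual.isSeqCompact_closedBall ℝ H (0 : StrongDual ℝ H) M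
  have hmem : ∀ n, StrongDual.toWeakDual (InnerProductSpace.toDual ℝ H (a n)) ∈
      WeakDual.toStrongDual ⁻¹' Metric.closedBall (0 : StrongDual ℝ H) M := by
    intro n
    have : ‖InnerProductSpace.toDual ℝ H (a n)‖ ≤ M := by
      rw [LinearIsometryEquiv.norm_map]; exact ha n
    simpa using this
  obtain ⟨x, -, k, hk, hlim⟩ := hc hmem
  exact ⟨k, hk, _, tendsto_inner_of_tendsto_weakDual hlim⟩

end Hilbert

/-! ### Sequences bounded in a weighted `L²` space up to a vanishing part -/

/-- The square root of the weight of the `L²` space. -/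
noncomputable def l2Weight {d : ℕ} (p : Phase d) : ℝ := Real.exp (|p.2.1| / 16 - |p.1.1| / 2)

theorem continuous_l2Weight {d : ℕ} : Continuous (l2Weight (d := d)) := by
  unfold l2Weight; fun_prop

theorem l2Weight_pos {d : ℕ} (p : Phase d) : 0 < l2Weight p := Real.exp_pos _

/-- The square is `exp (-|u| / 8) exp |t|`, with `|t|` bounded on `K`. By Cauchy-Schwarz the
weighted `L²` space then embeds in `L¹_loc(dtdx; L¹(dudω))`, and dual tests divided by the weight
lie in `L²`. -/
theorem memLp_inv_l2Weight {d : ℕ} (R : ℝ) {K : Set (ℝ × Sp d)} (hK : IsCompact K) :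
    MemLp (fun p => (l2Weight p)⁻¹) 2 ((phaseMeasure d R).restrict (K ×ˢ univ)) := by
  have hcont : Continuous fun p : Phase d => (l2Weight p)⁻¹ :=
    continuous_l2Weight.inv₀ fun p => (l2Weight_pos p).ne'
  rw [memLp_two_iff_integrable_sq hcont.aestronglyMeasurable]
  obtain ⟨T, hT⟩ := (hK.image continuous_fst).isBounded.exists_norm_le
  rw [phaseMeasure, restrict_prod_univ]
  have hKfin : (timeSpaceMeasure d).restrict K univ ≠ ⊤ := by
    rw [Measure.restrict_apply_univ]; exact hK.measure_lt_top.ne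
  let Q : ℝ → ℝ := fun u => Real.exp T * ((1 + |u|) ^ 0 * Real.exp (-(1 / 8 * |u|)))
  have hQ : Integrable Q := (integrable_pow_mul_exp_neg 0 (by norm_num)).const_mul _
  have hQm : Measurable Q := by fun_prop
  refine ⟨(hcont.pow 2).aestronglyMeasurable, ?_⟩
  have hmem : ∀ᵐ p ∂(((timeSpaceMeasure d).restrict K).prod (energySphereMeasure d R)),
      p.1 ∈ K := Measure.quasiMeasurePreserving_fst.ae (ae_restrict_mem hK.measurableSet)
  calc ∫⁻ p, ‖(l2Weight p)⁻¹ ^ 2‖ₑ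
        ∂(((timeSpaceMeasure d).restrict K).prod (energySphereMeasure d R))
      ≤ ∫⁻ p, ENNReal.ofReal (Q p.2.1)
        ∂(((timeSpaceMeasure d).restrict K).prod (energySphereMeasure d R)) := by
        refine lintegral_mono_ae (hmem.mono fun p hp => ?_)
        have ht : |p.1.1| ≤ T := hT _ ⟨p.1, hp, rfl⟩
        rw [Real.enorm_of_nonneg (by positivity)]
        refine ENNReal.ofReal_le_ofReal ?_
        simp only [Q, l2Weight, pow_zero, one_mul]
        rw [← Real.exp_neg, ← Real.exp_nat_mul, ← Real.exp_add, Real.exp_le_exp]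
        push_cast
        linarith
    _ < ⊤ := by
        rw [lintegral_energy _ hQm.ennreal_ofReal]
        refine ENNReal.mul_lt_top (ENNReal.mul_lt_top ?_ (measure_lt_top _ _)) hKfin.lt_top
        exact lt_of_le_of_lt (lintegral_mono fun u => Real.ofReal_le_enorm _) hQ.2

/-- `F n = A n + B n`, where `A n` is bounded in a weighted `L²` space and `B n` tends to zero in
`L¹_loc(dtdx; L¹(dudω))`. -/
structure SplitSeq (d : ℕ) (R M : ℝ) (F A B : ℕ → Phase d → ℝ) : Prop where
  eq_add : ∀ n p, F n p = A n p + B n p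
  memLp : ∀ n, MemLp (fun p => A n p * l2Weight p) 2 (phaseMeasure d R)
  norm_le : ∀ n, eLpNorm (fun p => A n p * l2Weight p) 2 (phaseMeasure d R) ≤ ENNReal.ofReal M
  integrable : ∀ n, MemL1loc d R (B n)
  tendsto : ∀ K : Set (ℝ × Sp d), IsCompact K →
    Tendsto (fun n => ∫ p in K ×ˢ univ, |B n p| ∂(phaseMeasure d R)) atTop (𝓝 0)

theorem memL1loc_of_memLp {d : ℕ} {R : ℝ} {a : Phase d → ℝ}
    (ha : MemLp a 2 (phaseMeasure d R)) : MemL1loc d R fun p => a p * (l2Weight p)⁻¹ :=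
  fun _ hK => (ha.mono_measure Measure.restrict_le_self).integrable_mul (memLp_inv_l2Weight R hK)

/-- A function that is bounded by `C` and vanishes outside `K ×ˢ univ`, divided by the weight, is
square-integrable. -/
theorem memLp_inv_l2Weight_mul {d : ℕ} {R C : ℝ} {K : Set (ℝ × Sp d)} (hK : IsCompact K)
    {ψ : Phase d → ℝ} (hψm : AEStronglyMeasurable ψ (phaseMeasure d R))
    (hψ : ∀ᵐ p ∂(phaseMeasure d R), |ψ p| ≤ C)
    (hψK : ∀ᵐ p ∂(phaseMeasure d R), p.1 ∉ K → ψ p = 0) :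
    MemLp (fun p => (l2Weight p)⁻¹ * ψ p) 2 (phaseMeasure d R) := by
  have h1 : MemLp (fun p => (l2Weight p)⁻¹ * ψ p) 2
      ((phaseMeasure d R).restrict (K ×ˢ univ)) := by
    refine (memLp_inv_l2Weight R hK).of_le_mul (c := C) ?_ ?_
    · exact (continuous_l2Weight.inv₀ fun p => (l2Weight_pos p).ne').aestronglyMeasurable.mul
        hψm.restrict
    · filter_upwards [ae_restrict_of_ae hψ] with p hp
      rw [norm_mul, mul_comm, Real.norm_eq_abs (ψ p)]
      gcongr
  rw [← memLp_indicator_iff_restrict (hK.measurableSet.prod MeasurableSet.univ)] at h1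
  refine (memLp_congr_ae ?_).1 h1
  filter_upwards [hψK] with p hp
  by_cases hpK : p.1 ∈ K
  · rw [indicator_of_mem (by exact ⟨hpK, mem_univ _⟩)]
  · rw [indicator_of_notMem (by exact fun h => hpK h.1), hp hpK, mul_zero]

theorem IsDualTest.memLp {d : ℕ} (R : ℝ) {ψ : Phase d → ℝ} (hψ : IsDualTest ψ) :
    MemLp (fun p => (l2Weight p)⁻¹ * ψ p) 2 (phaseMeasure d R) := by
  obtain ⟨hm, ⟨C, hC⟩, K, hK, hKψ⟩ := hψ
  exact memLp_inv_l2Weight_mul hK hm.aestronglyMeasurable (Eventually.of_forall hC)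
    (Eventually.of_forall hKψ)

theorem integral_mul_eq_inner {d : ℕ} {R : ℝ} {a b : Phase d → ℝ}
    (ha : MemLp a 2 (phaseMeasure d R)) (hb : MemLp b 2 (phaseMeasure d R)) :
    ∫ p, a p * b p ∂(phaseMeasure d R) = inner ℝ (ha.toLp a) (hb.toLp b) := by
  rw [L2.inner_def]
  refine integral_congr_ae ?_
  filter_upwards [ha.coeFn_toLp, hb.coeFn_toLp] with p h1 h2
  rw [h1, h2]
  simp [mul_comm]

theorem integrable_mul_of_memL1loc {d : ℕ} {R C : ℝ} {F ψ : Phase d → ℝ} (hF : MemL1loc d R F)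
    {K : Set (ℝ × Sp d)} (hK : IsCompact K) (hψm : AEStronglyMeasurable ψ (phaseMeasure d R))
    (hψ : ∀ᵐ p ∂(phaseMeasure d R), |ψ p| ≤ C)
    (hψK : ∀ᵐ p ∂(phaseMeasure d R), p.1 ∉ K → ψ p = 0) :
    Integrable (fun p => F p * ψ p) (phaseMeasure d R) := by
  have h1 : IntegrableOn (fun p => F p * ψ p) (K ×ˢ univ) (phaseMeasure d R) :=
    (hF K hK).mul_bdd hψm.restrict (ae_restrict_of_ae hψ)
  rw [← integrable_indicator_iff (hK.measurableSet.prod MeasurableSet.univ)] at h1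
  refine h1.congr ?_
  filter_upwards [hψK] with p hp
  by_cases hpK : p.1 ∈ K
  · rw [indicator_of_mem (by exact ⟨hpK, mem_univ _⟩)]
  · rw [indicator_of_notMem (by exact fun h => hpK h.1), hp hpK, mul_zero]

theorem IsDualTest.integrable_mul {d : ℕ} {R : ℝ} {F ψ : Phase d → ℝ} (hF : MemL1loc d R F)
    (hψ : IsDualTest ψ) : Integrable (fun p => F p * ψ p) (phaseMeasure d R) := by
  obtain ⟨hm, ⟨C, hC⟩, K, hK, hKψ⟩ := hψ
  exact integrable_mul_of_memL1loc hF hK hm.aestronglyMeasurable (Eventually.of_forall hC)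
    (Eventually.of_forall hKψ)

namespace SplitSeq

variable {d : ℕ} {R M : ℝ} {F A B : ℕ → Phase d → ℝ}

theorem memL1loc_left (h : SplitSeq d R M F A B) (n : ℕ) : MemL1loc d R (A n) := by
  have := memL1loc_of_memLp (h.memLp n)
  convert this using 2 with p
  rw [mul_assoc, mul_inv_cancel₀ (l2Weight_pos p).ne', mul_one]

theorem memL1loc (h : SplitSeq d R M F A B) (n : ℕ) : MemL1loc d R (F n) := fun K hK => by
  have := ((h.memL1loc_left n) K hK).add (h.integrable n K hK)
  refine this.congr (Eventually.of_forall fun p => ?_)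
  simp [h.eq_add]

theorem tendsto_integral_right (h : SplitSeq d R M F A B) {C : ℝ} {K : Set (ℝ × Sp d)}
    (hK : IsCompact K) {ψ : ℕ → Phase d → ℝ}
    (hψ : ∀ n, ∀ᵐ p ∂(phaseMeasure d R), |ψ n p| ≤ C)
    (hψK : ∀ n, ∀ᵐ p ∂(phaseMeasure d R), p.1 ∉ K → ψ n p = 0) :
    Tendsto (fun n => ∫ p, B n p * ψ n p ∂(phaseMeasure d R)) atTop (𝓝 0) := by
  have hlim := (h.tendsto K hK).mul_const C
  rw [zero_mul] at hlim
  refine squeeze_zero_norm (fun n => ?_) hlim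
  have hKm : MeasurableSet (K ×ˢ (univ : Set (ℝ × Sp d))) := hK.measurableSet.prod MeasurableSet.univ
  have : ∫ p, B n p * ψ n p ∂(phaseMeasure d R) =
      ∫ p in K ×ˢ univ, B n p * ψ n p ∂(phaseMeasure d R) := by
    rw [← integral_indicator hKm]
    refine integral_congr_ae ?_
    filter_upwards [hψK n] with p hp
    by_cases hpK : p.1 ∈ K
    · rw [indicator_of_mem (by exact ⟨hpK, mem_univ _⟩)]
    · rw [indicator_of_notMem (by exact fun h => hpK h.1), hp hpK, mul_zero]
  rw [this, ← integral_mul_const]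
  refine norm_integral_le_of_norm_le (((h.integrable n K hK).abs).mul_const C) ?_
  filter_upwards [ae_restrict_of_ae (hψ n)] with p hp
  rw [norm_mul, Real.norm_eq_abs, Real.norm_eq_abs]
  gcongr

theorem integral_left_eq_inner (h : SplitSeq d R M F A B) (n : ℕ) {ψ : Phase d → ℝ}
    (hψ : MemLp (fun p => (l2Weight p)⁻¹ * ψ p) 2 (phaseMeasure d R)) :
    ∫ p, A n p * ψ p ∂(phaseMeasure d R) =
      inner ℝ ((h.memLp n).toLp _) (hψ.toLp _) := by
  rw [← integral_mul_eq_inner]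
  refine integral_congr_ae (Eventually.of_forall fun p => ?_)
  have := (l2Weight_pos p).ne'
  simp only
  field_simp

theorem norm_toLp_le (h : SplitSeq d R M F A B) (hM : 0 ≤ M) (n : ℕ) :
    ‖(h.memLp n).toLp _‖ ≤ M := by
  rw [Lp.norm_toLp]
  exact ENNReal.toReal_le_of_le_ofReal hM (h.norm_le n)

theorem integral_mul_eq (h : SplitSeq d R M F A B) (n : ℕ) {ψ : Phase d → ℝ} (hψ : IsDualTest ψ) :
    ∫ p, F n p * ψ p ∂(phaseMeasure d R) =
      inner ℝ ((h.memLp n).toLp _) ((hψ.memLp R).toLp _) +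
        ∫ p, B n p * ψ p ∂(phaseMeasure d R) := by
  rw [← h.integral_left_eq_inner n (hψ.memLp R), ← integral_add
    (hψ.integrable_mul (h.memL1loc_left n)) (hψ.integrable_mul (h.integrable n))]
  refine integral_congr_ae (Eventually.of_forall fun p => ?_)
  simp only [h.eq_add, add_mul]

theorem tendsto_integral_mul (h : SplitSeq d R M F A B) {ψ : Phase d → ℝ} (hψ : IsDualTest ψ) :
    Tendsto (fun n => ∫ p, B n p * ψ p ∂(phaseMeasure d R)) atTop (𝓝 0) := by
  obtain ⟨-, ⟨C, hC⟩, K, hK, hKψ⟩ := hψ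
  exact h.tendsto_integral_right hK (fun _ => Eventually.of_forall hC)
    fun _ => Eventually.of_forall hKψ

end SplitSeq

/-- The element of `L¹_loc(dtdx; L¹(dudω))` given by an element of the weighted `L²` space. -/
noncomputable def ofL2 {d : ℕ} {R : ℝ} (a : Lp ℝ 2 (phaseMeasure d R)) :
    {F : Phase d → ℝ // MemL1loc d R F} :=
  ⟨fun p => a p * (l2Weight p)⁻¹, memL1loc_of_memLp (Lp.memLp a)⟩

theorem integral_ofL2_mul {d : ℕ} {R : ℝ} (a : Lp ℝ 2 (phaseMeasure d R)) {ψ : Phase d → ℝ}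
    (hψ : IsDualTest ψ) :
    ∫ p, (ofL2 a).1 p * ψ p ∂(phaseMeasure d R) = inner ℝ a ((hψ.memLp R).toLp _) := by
  conv_rhs => rw [← Lp.toLp_coeFn a (Lp.memLp a)]
  rw [← integral_mul_eq_inner]
  simp only [ofL2, mul_assoc]

theorem le_nhds_weakTopology {d : ℕ} {R : ℝ} {l : Filter {F : Phase d → ℝ // MemL1loc d R F}}
    {G : {F : Phase d → ℝ // MemL1loc d R F}}
    (h : ∀ ψ, IsDualTest ψ → Tendsto (fun F : {F : Phase d → ℝ // MemL1loc d R F} =>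
      ∫ p, F.1 p * ψ p ∂(phaseMeasure d R)) l (𝓝 (∫ p, G.1 p * ψ p ∂(phaseMeasure d R)))) :
    l ≤ @nhds _ (weakTopology d R) G := by
  rw [weakTopology, nhds_iInf]
  refine le_iInf fun ψ => ?_
  rw [nhds_induced, ← tendsto_iff_comap]
  exact h ψ.1 ψ.2

/-- Only the Hilbert part `A` needs a subsequence: pairings of `B` with dual tests tend to zero. -/
theorem SplitSeq.exists_subseq {d : ℕ} {R M : ℝ} {F A B : ℕ → Phase d → ℝ}
    (h : SplitSeq d R M F A B) (hM : 0 ≤ M) :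
    ∃ k : ℕ → ℕ, StrictMono k ∧ ∃ G : Phase d → ℝ, WeakTendsto d R (fun n => F (k n)) G := by
  have : IsSeparable (phaseMeasure d R) := isSeparable_of_sigmaFinite _
  have : Fact ((2 : ENNReal) ≠ ⊤) := ⟨by norm_num⟩
  obtain ⟨k, hk, a, ha⟩ := exists_subseq_tendsto_inner (h.norm_toLp_le hM)
  refine ⟨k, hk, (ofL2 a).1, fun n => h.memL1loc _, (ofL2 a).2, fun ψ hψ => ?_⟩
  rw [integral_ofL2_mul a hψ]
  simp_rw [h.integral_mul_eq _ hψ]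
  simpa using (ha _).add ((h.tendsto_integral_mul hψ).comp hk.tendsto_atTop)

theorem SplitSeq.weaklyRelCompact {d : ℕ} {R M : ℝ} {F A B : ℕ → Phase d → ℝ}
    (h : SplitSeq d R M F A B) (hM : 0 ≤ M) : WeaklyRelCompact d R (range F) := by
  refine ⟨by rintro _ ⟨n, rfl⟩; exact h.memL1loc n, ?_⟩
  let := weakTopology d R
  -- The topology does not separate almost everywhere equal functions; the R1 property still makes
  -- the closure of a subset of a compact set compact.
  have : @R1Space {F : Phase d → ℝ // MemL1loc d R F} (weakTopology d R) :=
    R1Space.iInf fun ψ => R1Space.induced _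
  let F' : ℕ → {F : Phase d → ℝ // MemL1loc d R F} := fun n => ⟨F n, h.memL1loc n⟩
  -- The sequence together with all its possible limits. The ball is weakly compact, and an
  -- ultrafilter on the sequence is either principal or has a limit in the ball.
  let X := F' '' univ ∪ ofL2 '' Metric.closedBall (0 : Lp ℝ 2 (phaseMeasure d R)) M
  have hX : @IsCompact _ (weakTopology d R) X := by
    rw [@isCompact_iff_ultrafilter_le_nhds _ (weakTopology d R)]
    intro U hU
    rw [le_principal_iff, Ultrafilter.mem_coe, Ultrafilter.union_mem_iff] at hU
    rcases hU with hU | hU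
    · let V := Ultrafilter.ofComapInfPrincipal hU
      have hV : V.map F' = U := Ultrafilter.ofComapInfPrincipal_eq_of_map hU
      rcases V.le_cofinite_or_eq_pure with hV' | ⟨n, hn⟩
      · rw [Nat.cofinite_eq_atTop] at hV'
        obtain ⟨a, haM, ha⟩ := exists_ultrafilter_tendsto_inner V
          (Eventually.of_forall (h.norm_toLp_le hM))
        refine ⟨ofL2 a, Or.inr ⟨a, by simpa using haM, rfl⟩, le_nhds_weakTopology fun ψ hψ => ?_⟩
        rw [← hV, Ultrafilter.coe_map, tendsto_map'_iff, integral_ofL2_mul a hψ]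
        have : (fun F : {F : Phase d → ℝ // MemL1loc d R F} =>
            ∫ p, F.1 p * ψ p ∂(phaseMeasure d R)) ∘ F' =
            fun n => ∫ p, F n p * ψ p ∂(phaseMeasure d R) := rfl
        rw [this]
        simp_rw [h.integral_mul_eq _ hψ]
        simpa using (ha _).add ((h.tendsto_integral_mul hψ).mono_left hV')
      · refine ⟨F' n, Or.inl ⟨n, mem_univ _, rfl⟩, ?_⟩
        rw [← hV, hn, Ultrafilter.map_pure, Ultrafilter.coe_pure]
        exact pure_le_nhds _
    · let V := Ultrafilter.ofComapInfPrincipal hU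
      have hV : V.map ofL2 = U := Ultrafilter.ofComapInfPrincipal_eq_of_map hU
      have hball : ∀ᶠ a in (V : Filter (Lp ℝ 2 (phaseMeasure d R))), ‖id a‖ ≤ M := by
        filter_upwards [Ultrafilter.ofComapInfPrincipal_mem hU] with a ha
        simpa using ha
      obtain ⟨a, haM, ha⟩ := exists_ultrafilter_tendsto_inner V hball
      refine ⟨ofL2 a, Or.inr ⟨a, by simpa using haM, rfl⟩, le_nhds_weakTopology fun ψ hψ => ?_⟩
      rw [← hV, Ultrafilter.coe_map, tendsto_map'_iff, integral_ofL2_mul a hψ]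
      refine (ha _).congr fun b => ?_
      exact (integral_ofL2_mul b hψ).symm
  refine IsCompact.closure_of_subset hX ?_
  rintro G ⟨n, hn⟩
  exact Or.inl ⟨n, mem_univ _, Subtype.ext hn⟩

/-! ### Dominated sequences and the limit of the entropy inequality. -/

theorem EntropyDominated.lintegral_time_mul_le {d : ℕ} {δ R C η : ℝ} {j : ℝ → ℝ}
    {G E : Phase d → ℝ} (h : EntropyDominated d δ R C η j G E) {w : ℝ → ENNReal}
    (hw : Measurable w) :
    ∫⁻ p, w p.1.1 * ENNReal.ofReal (E p) ∂(phaseMeasure d R) ≤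
      ENNReal.ofReal C * ∫⁻ t, w t ∂timeMeasure := by
  have hm : AEMeasurable (fun p : Phase d => w p.1.1 * ENNReal.ofReal (E p)) (phaseMeasure d R) :=
    (hw.comp (measurable_fst.comp measurable_fst)).aemeasurable.mul
      h.aemeasurable_density.ennreal_ofReal
  rw [phaseMeasure, lintegral_slice_timeSpace hm, ← lintegral_const_mul _ hw]
  refine lintegral_mono_ae ?_
  filter_upwards [h.lintegral_le, aemeasurable_slice_timeSpace h.aemeasurable_density] with t ht hmt
  rw [lintegral_const_mul'' _ hmt.ennreal_ofReal, mul_comm]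
  exact mul_le_mul' ht le_rfl

/-- A sequence of functions that are dominated by energy densities, as the temperature vanishes. -/
structure DominatedSeq (d : ℕ) (δ R C J : ℝ) (η : ℕ → ℝ) (j : ℕ → ℝ → ℝ)
    (G E : ℕ → Phase d → ℝ) : Prop where
  pos : ∀ n, 0 < η n
  tendsto_zero : Tendsto η atTop (𝓝 0)
  measurable : ∀ n, Measurable (j n)
  nonneg : ∀ n u, 0 ≤ j n u
  le : ∀ n u, j n u ≤ J * (1 + |u|) ^ d
  tendsto_jac : ∀ u, Tendsto (fun n => j n u) atTop (𝓝 (1 / (2 * R)))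
  dominated : ∀ n, EntropyDominated d δ R C (η n) (j n) (G n) (E n)

theorem isCompact_image_fst {d : ℕ} {K : Set (ℝ × Sp d)} (hK : IsCompact K) :
    IsCompact (Prod.fst '' K) := hK.image continuous_fst

instance : IsFiniteMeasureOnCompacts timeMeasure := by unfold timeMeasure; infer_instance

theorem lintegral_exp_neg_abs_ne_top :
    ∫⁻ t, ENNReal.ofReal (Real.exp (-|t|)) ∂timeMeasure ≠ ⊤ := by
  have h := integrable_pow_mul_exp_neg 0 one_pos
  simp only [pow_zero, one_mul] at h
  refine ne_of_lt (lt_of_le_of_lt ?_ h.2)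
  exact (lintegral_mono' Measure.restrict_le_self fun t => Real.ofReal_le_enorm _)

/-- The constant `D` of `exists_split` depends only on `d`, `δ` and `J`, so the `L²` bound on `A n`
is uniform in `n`, while the `L¹` norm of `B n` on `K ×ˢ univ` is `O(η n)`. -/
theorem DominatedSeq.exists_splitSeq {d : ℕ} {δ R C J : ℝ} {η : ℕ → ℝ} {j : ℕ → ℝ → ℝ}
    {G E : ℕ → Phase d → ℝ} (hδ : 0 < δ) (hJ : 0 < J) (h : DominatedSeq d δ R C J η j G E) :
    ∃ M, 0 ≤ M ∧ ∃ A B, SplitSeq d R M (fun n => weighted (G n)) A B := by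
  obtain ⟨D, hD, hsplit⟩ := EntropyDominated.exists_split d hδ hJ
  have hAB := fun n => hsplit R C (η n) (j n) (G n) (E n) (h.pos n) (h.measurable n) (h.nonneg n)
    (h.le n) (h.dominated n)
  choose A B hA hB heq hbd using hAB
  set S : ENNReal := ENNReal.ofReal D * (ENNReal.ofReal C *
    ∫⁻ t, ENNReal.ofReal (Real.exp (-|t|)) ∂timeMeasure) with hS
  have hStop : S ≠ ⊤ := ENNReal.mul_ne_top ENNReal.ofReal_ne_top
    (ENNReal.mul_ne_top ENNReal.ofReal_ne_top lintegral_exp_neg_abs_ne_top)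
  have hStop' : S ^ (1 / 2 : ℝ) ≠ ⊤ := ENNReal.rpow_ne_top_of_nonneg (by norm_num) hStop
  have hAm : ∀ n, AEStronglyMeasurable (fun p => A n p * l2Weight p) (phaseMeasure d R) :=
    fun n => ((hA n).mul continuous_l2Weight.measurable.aemeasurable).aestronglyMeasurable
  have hnorm : ∀ n, eLpNorm (fun p => A n p * l2Weight p) 2 (phaseMeasure d R) ≤
      S ^ (1 / 2 : ℝ) := by
    intro n
    rw [eLpNorm_eq_lintegral_rpow_enorm_toReal (by norm_num) (by norm_num)]
    simp only [ENNReal.toReal_ofNat]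
    refine ENNReal.rpow_le_rpow ?_ (by norm_num)
    calc ∫⁻ p, ‖A n p * l2Weight p‖ₑ ^ (2 : ℝ) ∂(phaseMeasure d R)
        ≤ ∫⁻ p, ENNReal.ofReal D * (ENNReal.ofReal (Real.exp (-|p.1.1|)) *
            ENNReal.ofReal (E n p)) ∂(phaseMeasure d R) := by
          refine lintegral_mono_ae ((hbd n).mono fun p hp => ?_)
          rw [← ENNReal.ofReal_mul (by positivity), ← ENNReal.ofReal_mul hD.le,
            ENNReal.rpow_two, ← enorm_pow, Real.enorm_of_nonneg (by positivity)]
          refine ENNReal.ofReal_le_ofReal ?_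
          -- The factor `exp (-|t|)` makes the energy, bounded only for almost every time,
          -- integrable over the whole half-line.
          have : l2Weight p ^ 2 = Real.exp (|p.2.1| / 8) * Real.exp (-|p.1.1|) := by
            rw [l2Weight, ← Real.exp_nat_mul, ← Real.exp_add]; push_cast; ring_nf
          rw [mul_pow, this]
          calc _ = Real.exp (-|p.1.1|) * (A n p ^ 2 * Real.exp (|p.2.1| / 8)) := by ring
            _ ≤ Real.exp (-|p.1.1|) * (D * E n p) :=
                mul_le_mul_of_nonneg_left hp.1 (Real.exp_pos _).le
            _ = _ := by ring
      _ ≤ S := by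
          rw [lintegral_const_mul' _ _ ENNReal.ofReal_ne_top]
          exact mul_le_mul' le_rfl ((h.dominated n).lintegral_time_mul_le (by fun_prop))
  have hBint : ∀ n, ∀ K : Set (ℝ × Sp d), IsCompact K →
      ∫⁻ p in K ×ˢ univ, ‖B n p‖ₑ ∂(phaseMeasure d R) ≤
        ENNReal.ofReal (4 * η n / δ) * (ENNReal.ofReal C * timeMeasure (Prod.fst '' K)) := by
    intro n K hK
    have hKm := (isCompact_image_fst hK).measurableSet
    have hle := (h.dominated n).lintegral_time_mul_le
      (w := (Prod.fst '' K).indicator 1) (measurable_one.indicator hKm)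
    rw [lintegral_indicator_one hKm] at hle
    refine le_trans ?_ (mul_le_mul' le_rfl hle)
    have hpos := h.pos n
    rw [← lintegral_const_mul' _ _ ENNReal.ofReal_ne_top,
      ← lintegral_indicator (hK.measurableSet.prod MeasurableSet.univ)]
    refine lintegral_mono_ae ((hbd n).mono fun p hp => ?_)
    by_cases hpK : p.1 ∈ K
    · rw [indicator_of_mem (by exact ⟨hpK, mem_univ _⟩), indicator_of_mem (by exact ⟨p.1, hpK, rfl⟩),
        Pi.one_apply, one_mul, ← ENNReal.ofReal_mul (by positivity), Real.enorm_eq_ofReal_abs]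
      exact ENNReal.ofReal_le_ofReal hp.2
    · rw [indicator_of_notMem (by exact fun h => hpK h.1)]
      exact zero_le
  have hfin : ∀ n, ∀ K : Set (ℝ × Sp d), IsCompact K →
      ENNReal.ofReal (4 * η n / δ) * (ENNReal.ofReal C * timeMeasure (Prod.fst '' K)) ≠ ⊤ :=
    fun n K hK => ENNReal.mul_ne_top ENNReal.ofReal_ne_top (ENNReal.mul_ne_top ENNReal.ofReal_ne_top
      (isCompact_image_fst hK).measure_lt_top.ne)
  refine ⟨(S ^ (1 / 2 : ℝ)).toReal, ENNReal.toReal_nonneg, A, B, heq, fun n => ⟨hAm n, ?_⟩,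
    fun n => ?_, fun n K hK => ⟨(hB n).aestronglyMeasurable.restrict, ?_⟩, fun K hK => ?_⟩
  · exact (hnorm n).trans_lt hStop'.lt_top
  · rw [ENNReal.ofReal_toReal hStop']; exact hnorm n
  · exact (hBint n K hK).trans_lt (hfin n K hK).lt_top
  · have hlim : Tendsto (fun n => 4 * η n / δ *
        (ENNReal.ofReal C * timeMeasure (Prod.fst '' K)).toReal) atTop (𝓝 0) := by
      have := ((h.tendsto_zero.const_mul 4).div_const δ).mul_const
        (ENNReal.ofReal C * timeMeasure (Prod.fst '' K)).toReal
      simpa using this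
    refine squeeze_zero (fun n => integral_nonneg fun p => abs_nonneg _) (fun n => ?_) hlim
    have hpos := h.pos n
    have h1 := ENNReal.toReal_mono (hfin n K hK) (hBint n K hK)
    rw [ENNReal.toReal_mul, ENNReal.toReal_ofReal (by positivity)] at h1
    refine le_trans (le_of_eq ?_) h1
    simp_rw [← Real.norm_eq_abs]
    exact integral_norm_eq_lintegral_enorm (hB n).aestronglyMeasurable.restrict

theorem integrableOn_energy {d : ℕ} (R : ℝ) {Q : ℝ → ℝ} (hQ : Integrable Q) (hQm : Measurable Q)
    {K : Set (ℝ × Sp d)} (hK : IsCompact K) :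
    IntegrableOn (fun p : Phase d => Q p.2.1) (K ×ˢ univ) (phaseMeasure d R) := by
  refine ⟨(hQm.comp (measurable_fst.comp measurable_snd)).aestronglyMeasurable, ?_⟩
  rw [phaseMeasure, restrict_prod_univ, HasFiniteIntegral, lintegral_energy _ hQm.enorm,
    Measure.restrict_apply_univ]
  exact ENNReal.mul_lt_top (ENNReal.mul_lt_top hQ.2 (measure_lt_top _ _)) hK.measure_lt_top

theorem MemL1loc.aestronglyMeasurable {d : ℕ} {R : ℝ} {F : Phase d → ℝ} (hF : MemL1loc d R F) :
    AEStronglyMeasurable F (phaseMeasure d R) := by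
  have h : ⋃ n, (compactCovering (ℝ × Sp d) n) ×ˢ (univ : Set (ℝ × Sp d)) = univ := by
    rw [← iUnion_prod_const, iUnion_compactCovering, univ_prod_univ]
  rw [← Measure.restrict_univ (μ := phaseMeasure d R), ← h, aestronglyMeasurable_iUnion_iff]
  exact fun n => (hF _ (isCompact_compactCovering _ n)).1

theorem aemeasurable_of_weighted {d : ℕ} {R : ℝ} {F : Phase d → ℝ}
    (hF : MemL1loc d R (weighted F)) : AEMeasurable F (phaseMeasure d R) := by
  have h1 : Measurable fun p : Phase d => (1 + |p.2.1|)⁻¹ := by fun_prop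
  refine (h1.aemeasurable.mul hF.aestronglyMeasurable.aemeasurable).congr
    (Eventually.of_forall fun p => ?_)
  have : 1 + |p.2.1| ≠ 0 := by positivity
  simp only [Pi.mul_apply, weighted]
  field_simp

theorem IsDualTest.div_weight {d : ℕ} {ψ : Phase d → ℝ} (hψ : IsDualTest ψ) (c : ℝ) :
    IsDualTest fun p => c * ψ p / (1 + |p.2.1|) := by
  obtain ⟨hm, ⟨C, hC⟩, K, hK, hKψ⟩ := hψ
  refine ⟨by fun_prop, ⟨|c| * C, fun p => ?_⟩, K, hK, fun p hp => by simp [hKψ p hp]⟩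
  rw [abs_div, abs_mul, abs_of_nonneg (a := 1 + |p.2.1|) (by positivity)]
  refine (div_le_self (by positivity) (by linarith [abs_nonneg p.2.1])).trans ?_
  gcongr
  exact hC p

theorem weighted_mul_div {d : ℕ} (F ψ : Phase d → ℝ) (c : ℝ) (p : Phase d) :
    weighted F p * (c * ψ p / (1 + |p.2.1|)) = c * F p * ψ p := by
  have : 1 + |p.2.1| ≠ 0 := by positivity
  rw [weighted]
  field_simp

/-- The limit of the entropy inequality, tested against a bounded function. -/
theorem DominatedSeq.integral_le {d : ℕ} {δ R C J : ℝ} {η : ℕ → ℝ} {j : ℕ → ℝ → ℝ}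
    {G E : ℕ → Phase d → ℝ} (hC : 0 ≤ C) (hJ : 0 < J) (h : DominatedSeq d δ R C J η j G E)
    {gt : Phase d → ℝ} (hgt : WeakTendsto d R (fun n => weighted (G n)) (weighted gt))
    {ψ : Phase d → ℝ} (hψ : IsDualTest ψ) {A : Set ℝ} (hA : MeasurableSet A)
    (hAfin : timeMeasure A ≠ ⊤) (hψA : ∀ p : Phase d, p.1.1 ∉ A → ψ p = 0) :
    ∫ p, δ * gt p * ψ p ∂(phaseMeasure d R) ≤
      C * (timeMeasure A).toReal +
        ∫ p, 1 / (2 * R) * ψ p ^ 2 * halfVariance p.2.1 ∂(phaseMeasure d R) := by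
  -- The convergence concerns the functions multiplied by `1 + |u|`, so the weight is divided out of
  -- the test.
  have hlim := hgt.2.2 _ (hψ.div_weight δ)
  simp_rw [weighted_mul_div] at hlim
  have hψ' := hψ
  obtain ⟨hm, ⟨L, hL⟩, K, hK, hKψ⟩ := hψ'
  obtain ⟨η₀, hη₀⟩ := h.tendsto_zero.bddAbove_range
  have hη₀' : ∀ n, η n ≤ η₀ := fun n => hη₀ ⟨n, rfl⟩
  have hL0 : 0 ≤ L := (abs_nonneg _).trans (hL default)
  let Q : ℝ → ℝ := fun u => J * L ^ 2 * Real.exp (η₀ * L) / 2 *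
    ((1 + |u|) ^ d * Real.exp (-(1 * |u|)))
  have hQi : Integrable Q := (integrable_pow_mul_exp_neg d one_pos).const_mul _
  have hQm : Measurable Q := by fun_prop
  have hbound := (integrable_indicator_iff (hK.measurableSet.prod MeasurableSet.univ)).2
    (integrableOn_energy R hQi hQm hK)
  let I : ℕ → Phase d → ℝ := fun n p =>
    j n p.2.1 * ψ p ^ 2 * Real.exp (η n * |ψ p|) * halfVariance p.2.1
  have hIm : ∀ n, Measurable (I n) := fun n => by
    have h1 : Measurable fun p : Phase d => j n p.2.1 :=
      (h.measurable n).comp (measurable_fst.comp measurable_snd)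
    have h2 : Measurable fun p : Phase d => halfVariance p.2.1 :=
      continuous_halfVariance.measurable.comp (measurable_fst.comp measurable_snd)
    exact ((h1.mul (hm.pow_const 2)).mul ((hm.abs.const_mul (η n)).exp)).mul h2
  have hIle : ∀ n p, ‖I n p‖ ≤
      (K ×ˢ (univ : Set (ℝ × Sp d))).indicator (fun p : Phase d => Q p.2.1) p := by
    intro n p
    have hj := h.nonneg n p.2.1
    have hq := (halfVariance_pos p.2.1).le
    by_cases hpK : p.1 ∈ K
    · rw [indicator_of_mem (by exact ⟨hpK, mem_univ _⟩), Real.norm_of_nonneg (by positivity)]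
      have h1 : ψ p ^ 2 ≤ L ^ 2 := by rw [← sq_abs]; have := hL p; gcongr
      have h2 : η n * |ψ p| ≤ η₀ * L :=
        mul_le_mul (hη₀' n) (hL p) (abs_nonneg _) ((h.pos n).le.trans (hη₀' n))
      calc I n p ≤ (J * (1 + |p.2.1|) ^ d) * L ^ 2 * Real.exp (η₀ * L) *
            (Real.exp (-|p.2.1|) / 2) := by
            have h3 := h.le n p.2.1
            have h4 := halfVariance_le p.2.1
            simp only [I]
            gcongr
        _ = Q p.2.1 := by simp only [Q, one_mul]; ring
    · rw [indicator_of_notMem (by exact fun h => hpK h.1)]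
      simp [I, hKψ p hpK]
  have hIint : ∀ n, Integrable (I n) (phaseMeasure d R) := fun n =>
    hbound.mono' (hIm n).aestronglyMeasurable (Eventually.of_forall (hIle n))
  have hIlim : Tendsto (fun n => ∫ p, I n p ∂(phaseMeasure d R)) atTop
      (𝓝 (∫ p, 1 / (2 * R) * ψ p ^ 2 * halfVariance p.2.1 ∂(phaseMeasure d R))) := by
    refine tendsto_integral_of_dominated_convergence _ (fun n => (hIm n).aestronglyMeasurable)
      hbound (fun n => Eventually.of_forall (hIle n)) (Eventually.of_forall fun p => ?_)
    have he : Tendsto (fun n => Real.exp (η n * |ψ p|)) atTop (𝓝 1) := by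
      have := (Real.continuous_exp.tendsto _).comp (h.tendsto_zero.mul_const |ψ p|)
      simpa [Function.comp_def] using this
    have := (((h.tendsto_jac p.2.1).mul_const (ψ p ^ 2)).mul he).mul_const (halfVariance p.2.1)
    simpa using this
  refine le_of_tendsto_of_tendsto' hlim (hIlim.const_add _) fun n => ?_
  have hE0 := (h.dominated n).density_nonneg
  have hEm := (h.dominated n).aemeasurable_density
  have hAm : MeasurableSet {p : Phase d | p.1.1 ∈ A} :=
    hA.preimage (measurable_fst.comp measurable_fst)
  -- Since `ψ` vanishes for times outside `A`, the energy is needed only there, where its integral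
  -- is at most `C |A|`.
  let EA : Phase d → ℝ := indicator {p : Phase d | p.1.1 ∈ A} (E n)
  have hEAm : AEStronglyMeasurable EA (phaseMeasure d R) :=
    (hEm.indicator hAm).aestronglyMeasurable
  have hEA0 : 0 ≤ᵐ[phaseMeasure d R] EA := hE0.mono fun p hp => by
    simp only [EA, indicator]; split_ifs <;> simp [hp]
  have hEAle : ∫⁻ p, ENNReal.ofReal (EA p) ∂(phaseMeasure d R) ≤
      ENNReal.ofReal C * timeMeasure A := by
    have hle := (h.dominated n).lintegral_time_mul_le
      (w := A.indicator 1) (measurable_one.indicator hA)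
    rw [lintegral_indicator_one hA] at hle
    refine le_trans (lintegral_mono fun p => ?_) hle
    by_cases hp : p.1.1 ∈ A
    · simp [EA, hp]
    · simp [EA, hp]
  have hEAtop : ENNReal.ofReal C * timeMeasure A ≠ ⊤ :=
    ENNReal.mul_ne_top ENNReal.ofReal_ne_top hAfin
  have hEAint : Integrable EA (phaseMeasure d R) :=
    ⟨hEAm, (hasFiniteIntegral_iff_ofReal hEA0).2 (hEAle.trans_lt hEAtop.lt_top)⟩
  have hEAval : ∫ p, EA p ∂(phaseMeasure d R) ≤ C * (timeMeasure A).toReal := by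
    rw [integral_eq_lintegral_of_nonneg_ae hEA0 hEAm]
    have := ENNReal.toReal_mono hEAtop hEAle
    rwa [ENNReal.toReal_mul, ENNReal.toReal_ofReal hC] at this
  have hGint : Integrable (fun p => δ * G n p * ψ p) (phaseMeasure d R) := by
    have := (hψ.div_weight δ).integrable_mul (hgt.1 n)
    simpa only [weighted_mul_div] using this
  calc ∫ p, δ * G n p * ψ p ∂(phaseMeasure d R)
      ≤ ∫ p, EA p + I n p ∂(phaseMeasure d R) := by
        refine integral_mono_ae hGint (hEAint.add (hIint n)) ?_
        filter_upwards [(h.dominated n).mul_le] with p hp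
        by_cases hpA : p.1.1 ∈ A
        · simpa [EA, hpA, I] using hp (ψ p)
        · simp [EA, hpA, I, hψA p hpA]
    _ = ∫ p, EA p ∂(phaseMeasure d R) + ∫ p, I n p ∂(phaseMeasure d R) :=
        integral_add hEAint (hIint n)
    _ ≤ _ := by gcongr

/-! ### The limiting entropy bound -/

/-- The limiting inequality is optimized over the test function. Truncation to `D` makes the
optimizer an admissible test, and the arbitrary time set `A` turns the integrated bound into one for
almost every `t`. -/
theorem DominatedSeq.ae_lintegral_truncated_le {d : ℕ} {δ R C J : ℝ} {η : ℕ → ℝ} {j : ℕ → ℝ → ℝ}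
    {G E : ℕ → Phase d → ℝ} (hδ : 0 < δ) (hR : 0 < R) (hC : 0 ≤ C) (hJ : 0 < J)
    (h : DominatedSeq d δ R C J η j G E) {gt : Phase d → ℝ}
    (hgt : WeakTendsto d R (fun n => weighted (G n)) (weighted gt)) {g₀ : Phase d → ℝ}
    (hg₀ : Measurable g₀) (hgg₀ : gt =ᵐ[phaseMeasure d R] g₀) {D : Set (Phase d)}
    (hD : MeasurableSet D) {N : ℝ} (hN : 0 ≤ N)
    (hDN : ∀ p ∈ D, ‖p.1‖ ≤ N ∧ |p.2.1| ≤ N ∧ |g₀ p| ≤ N) :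
    ∀ᵐ t ∂timeMeasure, ∫⁻ z : Sp d × (ℝ × Sp d),
      ENNReal.ofReal (D.indicator (fun p => (g₀ p * Real.cosh (p.2.1 / 2)) ^ 2) ((t, z.1), z.2))
        ∂((volume : Measure (Sp d)).prod (energySphereMeasure d R)) ≤
        ENNReal.ofReal (C / (4 * R * δ ^ 2)) := by
  have hu : Measurable fun p : Phase d => p.2.1 := measurable_fst.comp measurable_snd
  have hcosh : Measurable fun p : Phase d => Real.cosh (p.2.1 / 2) :=
    Real.continuous_cosh.measurable.comp (hu.div_const 2)
  set k : Phase d → ℝ := D.indicator fun p => (g₀ p * Real.cosh (p.2.1 / 2)) ^ 2 with hkdef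
  have hk : Measurable k := ((hg₀.mul hcosh).pow_const 2).indicator hD
  have hk0 : ∀ p, 0 ≤ k p := fun p => indicator_nonneg (fun _ _ => sq_nonneg _) p
  have hΦm : Measurable fun t : ℝ => ∫⁻ z : Sp d × (ℝ × Sp d),
      ENNReal.ofReal (k ((t, z.1), z.2))
        ∂((volume : Measure (Sp d)).prod (energySphereMeasure d R)) := by
    refine Measurable.lintegral_prod_right'
      (f := fun q : ℝ × (Sp d × (ℝ × Sp d)) => ENNReal.ofReal (k ((q.1, q.2.1), q.2.2))) ?_
    exact (hk.comp (by fun_prop)).ennreal_ofReal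
  refine ae_le_of_forall_setLIntegral_le_of_sigmaFinite hΦm fun A hA hAfin => ?_
  rw [setLIntegral_const]
  have hTA : MeasurableSet {p : Phase d | p.1.1 ∈ A} :=
    hA.preimage (measurable_fst.comp measurable_fst)
  -- Pointwise maximizer of `δ g₀ ψ - ψ² / (16 R cosh² (u/2))`, cut off to `D` and to times in `A`.
  let ψ : Phase d → ℝ := {p : Phase d | p.1.1 ∈ A}.indicator (D.indicator
    fun p => 8 * R * δ * g₀ p * Real.cosh (p.2.1 / 2) ^ 2)
  let kA : Phase d → ℝ := {p : Phase d | p.1.1 ∈ A}.indicator (k)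
  have hkA0 : ∀ p, 0 ≤ kA p := fun p => indicator_nonneg (fun _ _ => hk0 _) p
  have hψ : IsDualTest ψ := by
    refine ⟨?_, ⟨8 * R * δ * N * Real.cosh (N / 2) ^ 2, fun p => ?_⟩,
      Metric.closedBall 0 N, isCompact_closedBall _ _, fun p hp => ?_⟩
    · exact (((hg₀.const_mul _).mul (hcosh.pow_const 2)).indicator hD).indicator hTA
    · have h0 : 0 ≤ 8 * R * δ * N * Real.cosh (N / 2) ^ 2 := by positivity
      simp only [ψ, indicator]
      split_ifs with h1 h2
      · obtain ⟨-, h3, h4⟩ := hDN p h2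
        have hc : Real.cosh (p.2.1 / 2) ≤ Real.cosh (N / 2) := by
          rw [Real.cosh_le_cosh, abs_div, abs_div, abs_two, abs_of_nonneg hN]
          linarith
        have hc0 := Real.cosh_pos (p.2.1 / 2)
        rw [abs_mul, abs_mul, abs_of_nonneg (a := 8 * R * δ) (by positivity),
          abs_of_nonneg (a := Real.cosh (p.2.1 / 2) ^ 2) (by positivity)]
        gcongr
      · simpa using h0
      · simpa using h0
    · have : p ∉ D := fun hpD => hp (by simpa using (hDN p hpD).1)
      simp [ψ, indicator, this]
  have hψA : ∀ p : Phase d, p.1.1 ∉ A → ψ p = 0 := fun p hp => by simp [ψ, hp]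
  have hmain := h.integral_le hC hJ hgt hψ hA hAfin.ne hψA
  have h1 : ∀ p, δ * g₀ p * ψ p = 8 * R * δ ^ 2 * kA p := fun p => by
    simp only [ψ, kA, k, indicator]
    split_ifs <;> ring
  have h2 : ∀ p, 1 / (2 * R) * ψ p ^ 2 * halfVariance p.2.1 = 4 * R * δ ^ 2 * kA p := fun p => by
    have hc := (Real.cosh_pos (p.2.1 / 2)).ne'
    simp only [ψ, kA, k, indicator, halfVariance]
    split_ifs
    · field_simp; ring
    · simp
    · simp
  have h3 : ∀ᵐ p ∂(phaseMeasure d R), δ * gt p * ψ p = 8 * R * δ ^ 2 * kA p :=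
    hgg₀.mono fun p hp => by rw [hp, h1]
  have hc0 : 8 * R * δ ^ 2 ≠ 0 := by positivity
  -- `kA` is a multiple of `gt * ψ`, integrable because `weighted gt` lies in `L¹_loc` and `ψ` is a
  -- dual test. Without this the Bochner integral would not control the lower Lebesgue integral.
  have hint : Integrable kA (phaseMeasure d R) := by
    have h4 := (hψ.div_weight δ).integrable_mul hgt.2.1
    simp only [weighted_mul_div] at h4
    have h5 := (h4.congr h3).const_mul (8 * R * δ ^ 2)⁻¹
    refine h5.congr (Eventually.of_forall fun p => ?_)
    simp only
    rw [inv_mul_cancel_left₀ hc0]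
  rw [integral_congr_ae h3] at hmain
  simp_rw [h2] at hmain
  rw [integral_const_mul, integral_const_mul] at hmain
  -- The linear term has coefficient `8 R δ²` and the quadratic one `4 R δ²`; the difference gives
  -- the constant.
  have hI : ∫ p, kA p ∂(phaseMeasure d R) ≤ C / (4 * R * δ ^ 2) * (timeMeasure A).toReal := by
    rw [div_mul_eq_mul_div, le_div_iff₀ (by positivity)]
    linarith
  calc ∫⁻ t in A, ∫⁻ z : Sp d × (ℝ × Sp d), ENNReal.ofReal (k ((t, z.1), z.2))
        ∂((volume : Measure (Sp d)).prod (energySphereMeasure d R)) ∂timeMeasure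
      = ∫⁻ p, ENNReal.ofReal (kA p) ∂(phaseMeasure d R) := by
        rw [phaseMeasure, lintegral_slice_timeSpace
          (hk.indicator hTA).ennreal_ofReal.aemeasurable, ← lintegral_indicator hA]
        refine lintegral_congr fun t => ?_
        by_cases ht : t ∈ A <;> simp [ht, indicator]
    _ = ENNReal.ofReal (∫ p, kA p ∂(phaseMeasure d R)) :=
        (ofReal_integral_eq_lintegral_ofReal hint (Eventually.of_forall hkA0)).symm
    _ ≤ ENNReal.ofReal (C / (4 * R * δ ^ 2) * (timeMeasure A).toReal) :=
        ENNReal.ofReal_le_ofReal hI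
    _ = _ := by rw [ENNReal.ofReal_mul (by positivity), ENNReal.ofReal_toReal hAfin.ne]

/-- Monotone convergence removes the truncation; integer levels keep the union of the exceptional
time sets null. -/
theorem DominatedSeq.ae_lintegral_cosh_le {d : ℕ} {δ R C J : ℝ} {η : ℕ → ℝ} {j : ℕ → ℝ → ℝ}
    {G E : ℕ → Phase d → ℝ} (hδ : 0 < δ) (hR : 0 < R) (hC : 0 ≤ C) (hJ : 0 < J)
    (h : DominatedSeq d δ R C J η j G E) {gt : Phase d → ℝ}
    (hgt : WeakTendsto d R (fun n => weighted (G n)) (weighted gt)) :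
    ∀ᵐ t ∂timeMeasure, ∫⁻ z : Sp d × (ℝ × Sp d),
      ENNReal.ofReal ((gt ((t, z.1), z.2) * Real.cosh (z.2.1 / 2)) ^ 2)
      ∂((volume : Measure (Sp d)).prod (energySphereMeasure d R)) ≤
        ENNReal.ofReal (C / (4 * R * δ ^ 2)) := by
  obtain ⟨g₀, hg₀, hgg₀⟩ := aemeasurable_of_weighted hgt.2.1
  have hu : Measurable fun p : Phase d => p.2.1 := measurable_fst.comp measurable_snd
  have hcosh : Measurable fun p : Phase d => Real.cosh (p.2.1 / 2) :=
    Real.continuous_cosh.measurable.comp (hu.div_const 2)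
  let D : ℕ → Set (Phase d) := fun N => {p | ‖p.1‖ ≤ N ∧ |p.2.1| ≤ N ∧ |g₀ p| ≤ N}
  have hD : ∀ N, MeasurableSet (D N) := fun N =>
    (measurableSet_le measurable_fst.norm measurable_const).inter
      ((measurableSet_le hu.abs measurable_const).inter
        (measurableSet_le hg₀.abs measurable_const))
  let k : ℕ → Phase d → ℝ := fun N =>
    (D N).indicator fun p => (g₀ p * Real.cosh (p.2.1 / 2)) ^ 2
  have hk : ∀ N, Measurable (k N) := fun N => ((hg₀.mul hcosh).pow_const 2).indicator (hD N)
  have hslice : ∀ t : ℝ, Measurable fun z : Sp d × (ℝ × Sp d) => (((t, z.1), z.2) : Phase d) :=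
    fun t => by fun_prop
  have hΦ : ∀ N : ℕ, ∀ᵐ t ∂timeMeasure, ∫⁻ z : Sp d × (ℝ × Sp d),
      ENNReal.ofReal (k N ((t, z.1), z.2))
        ∂((volume : Measure (Sp d)).prod (energySphereMeasure d R)) ≤
        ENNReal.ofReal (C / (4 * R * δ ^ 2)) := by
    intro N
    exact h.ae_lintegral_truncated_le hδ hR hC hJ hgt hg₀ hgg₀ (hD N) (Nat.cast_nonneg N)
      fun p hp => hp
  filter_upwards [ae_all_iff.2 hΦ, ae_slice_timeSpace hgg₀] with t ht hgt'
  have heq : ∫⁻ z : Sp d × (ℝ × Sp d),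
      ENNReal.ofReal ((gt ((t, z.1), z.2) * Real.cosh (z.2.1 / 2)) ^ 2)
      ∂((volume : Measure (Sp d)).prod (energySphereMeasure d R)) = ∫⁻ z : Sp d × (ℝ × Sp d),
      ENNReal.ofReal ((g₀ ((t, z.1), z.2) * Real.cosh (z.2.1 / 2)) ^ 2)
      ∂((volume : Measure (Sp d)).prod (energySphereMeasure d R)) :=
    lintegral_congr_ae (hgt'.mono fun z hz => by simp only [hz])
  rw [heq]
  have hmono : ∀ z : Sp d × (ℝ × Sp d), Monotone fun N =>
      ENNReal.ofReal (k N ((t, z.1), z.2)) := fun z N N' hNN => by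
    have hcast : (N : ℝ) ≤ N' := Nat.cast_le.2 hNN
    have hsub : D N ⊆ D N' :=
      fun p hp => ⟨hp.1.trans hcast, hp.2.1.trans hcast, hp.2.2.trans hcast⟩
    exact ENNReal.ofReal_le_ofReal
      (indicator_le_indicator_of_subset hsub (fun _ => sq_nonneg _) _)
  have hlim : ∀ z : Sp d × (ℝ × Sp d), Tendsto (fun N => ENNReal.ofReal (k N ((t, z.1), z.2)))
      atTop (𝓝 (ENNReal.ofReal ((g₀ ((t, z.1), z.2) * Real.cosh (z.2.1 / 2)) ^ 2))) := fun z => by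
    refine tendsto_const_nhds.congr' ?_
    obtain ⟨N₀, hN₀⟩ := exists_nat_ge (max ‖((t, z.1) : ℝ × Sp d)‖
      (max |z.2.1| |g₀ ((t, z.1), z.2)|))
    filter_upwards [eventually_ge_atTop N₀] with N hN
    have hcast : (N₀ : ℝ) ≤ N := Nat.cast_le.2 hN
    have hle := hN₀.trans hcast
    rw [max_le_iff, max_le_iff] at hle
    have hmem : (((t, z.1), z.2) : Phase d) ∈ D N := hle
    simp only [k]
    rw [indicator_of_mem hmem]
  exact le_of_tendsto' (lintegral_tendsto_of_tendsto_of_monotone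
    (fun N => ((hk N).comp (hslice t)).ennreal_ofReal.aemeasurable)
    (Eventually.of_forall hmono) (Eventually.of_forall hlim)) ht

/-! ### Strongly converging test functions -/

namespace SplitSeq

variable {d : ℕ} {R M : ℝ} {F A B : ℕ → Phase d → ℝ}

/-- By dominated convergence `ψ n / l2Weight` tends to zero strongly in `L²`, hence so do its
pairings with the bounded part `A`. The part `B` is already small in `L¹`, where bounded tests
suffice. -/
theorem tendsto_integral_of_tendsto_zero (h : SplitSeq d R M F A B) (hM : 0 ≤ M) {C : ℝ}
    {K : Set (ℝ × Sp d)} (hK : IsCompact K) {ψ : ℕ → Phase d → ℝ}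
    (hψm : ∀ n, Measurable (ψ n))
    (hψ : ∀ n, ∀ᵐ p ∂(phaseMeasure d R), |ψ n p| ≤ C)
    (hψK : ∀ n, ∀ᵐ p ∂(phaseMeasure d R), p.1 ∉ K → ψ n p = 0)
    (hlim : ∀ᵐ p ∂(phaseMeasure d R), Tendsto (fun n => ψ n p) atTop (𝓝 0)) :
    Tendsto (fun n => ∫ p, F n p * ψ n p ∂(phaseMeasure d R)) atTop (𝓝 0) := by
  have hb := fun n => memLp_inv_l2Weight_mul (R := R) hK (hψm n).aestronglyMeasurable
    (hψ n) (hψK n)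
  have hKm : MeasurableSet (K ×ˢ (univ : Set (ℝ × Sp d))) :=
    hK.measurableSet.prod MeasurableSet.univ
  have hbound : Integrable ((K ×ˢ (univ : Set (ℝ × Sp d))).indicator
      fun p => C ^ 2 * (l2Weight p)⁻¹ ^ 2) (phaseMeasure d R) := by
    rw [integrable_indicator_iff hKm]
    exact ((memLp_inv_l2Weight R hK).integrable_sq).const_mul _
  have hWm : Measurable fun p : Phase d => (l2Weight p)⁻¹ := continuous_l2Weight.measurable.inv
  have hsq : Tendsto (fun n => ∫ p, ((l2Weight p)⁻¹ * ψ n p) * ((l2Weight p)⁻¹ * ψ n p)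
      ∂(phaseMeasure d R)) atTop (𝓝 0) := by
    rw [← integral_zero (Phase d) ℝ (μ := phaseMeasure d R)]
    refine tendsto_integral_of_dominated_convergence _
      (fun n => ((hWm.mul (hψm n)).mul (hWm.mul (hψm n))).aestronglyMeasurable) hbound
      (fun n => ?_) ?_
    · filter_upwards [hψ n, hψK n] with p hp hpK
      by_cases hK' : p.1 ∈ K
      · rw [indicator_of_mem (by exact ⟨hK', mem_univ _⟩), Real.norm_of_nonneg (mul_self_nonneg _)]
        have : ψ n p ^ 2 ≤ C ^ 2 := by rw [← sq_abs]; gcongr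
        calc _ = ψ n p ^ 2 * (l2Weight p)⁻¹ ^ 2 := by ring
          _ ≤ _ := by gcongr
      · rw [indicator_of_notMem (by exact fun h => hK' h.1), hpK hK']
        simp
    · filter_upwards [hlim] with p hp
      have := (hp.const_mul (l2Weight p)⁻¹).mul (hp.const_mul (l2Weight p)⁻¹)
      simpa using this
  have hnorm : Tendsto (fun n => ‖(hb n).toLp _‖) atTop (𝓝 0) := by
    have h1 := hsq.sqrt
    rw [Real.sqrt_zero] at h1
    refine h1.congr fun n => ?_
    rw [integral_mul_eq_inner (hb n) (hb n), real_inner_self_eq_norm_sq,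
      Real.sqrt_sq (norm_nonneg _)]
  have hA : Tendsto (fun n => ∫ p, A n p * ψ n p ∂(phaseMeasure d R)) atTop (𝓝 0) := by
    have h1 := hnorm.const_mul M
    rw [mul_zero] at h1
    refine squeeze_zero_norm (fun n => ?_) h1
    rw [h.integral_left_eq_inner n (hb n)]
    refine (norm_inner_le_norm _ _).trans ?_
    gcongr
    exact h.norm_toLp_le hM n
  have hB := h.tendsto_integral_right hK hψ hψK
  have hsum := hA.add hB
  rw [add_zero] at hsum
  refine hsum.congr fun n => ?_
  rw [← integral_add
    (integrable_mul_of_memL1loc (h.memL1loc_left n) hK (hψm n).aestronglyMeasurable (hψ n) (hψK n))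
    (integrable_mul_of_memL1loc (h.integrable n) hK (hψm n).aestronglyMeasurable (hψ n) (hψK n))]
  refine integral_congr_ae (Eventually.of_forall fun p => ?_)
  simp only [h.eq_add, add_mul]

end SplitSeq

theorem ae_phaseMeasure_time_nonneg (d : ℕ) (R : ℝ) :
    ∀ᵐ p ∂(phaseMeasure d R), 0 ≤ p.1.1 := by
  have h1 : ∀ᵐ t ∂timeMeasure, 0 ≤ t := ae_restrict_mem measurableSet_Ici
  have h2 : ∀ᵐ q : ℝ × Sp d ∂(timeSpaceMeasure d), 0 ≤ q.1 :=
    Measure.quasiMeasurePreserving_fst.ae h1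
  exact Measure.quasiMeasurePreserving_fst.ae h2

/-- Weak convergence tested against continuous functions composed with the velocity. -/
theorem SplitSeq.tendsto_growthTest {d : ℕ} {R M τ : ℝ} {ε : ℕ → ℝ} {G A B : ℕ → Phase d → ℝ}
    {gt : Phase d → ℝ} (hM : 0 ≤ M) (h : SplitSeq d R M (fun n => weighted (G n)) A B)
    (hgt : WeakTendsto d R (fun n => weighted (G n)) (weighted gt))
    (hε : Tendsto (fun n => ε n ^ τ) atTop (𝓝 0)) {φ : Phase d → ℝ} (hφ : IsGrowthTest φ) :
    Tendsto (fun n => ∫ p, G n p * φ (p.1, (p.2.1, dilVelocity R τ (ε n) p.2.1 p.2.2))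
      ∂(phaseMeasure d R)) atTop (𝓝 (∫ p, gt p * φ p ∂(phaseMeasure d R))) := by
  obtain ⟨hcont, ⟨K, hK, hKφ⟩, C, hC⟩ := hφ
  let S : Set (Phase d) := {p | 0 ≤ p.1.1}
  have hS : MeasurableSet S :=
    measurableSet_le measurable_const (measurable_fst.comp measurable_fst)
  have hC0 : 0 ≤ C := by
    have hmem : (0 : ℝ) ≤ ((((0 : ℝ), (0 : Sp d)), ((0 : ℝ), (0 : Sp d))) : Phase d).1.1 := le_rfl
    exact le_trans (by positivity) (hC _ hmem)
  classical
  -- Nothing is known about `φ` for negative times, not even measurability; extension by zero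
  -- changes no integral.
  let φ₀ : Phase d → ℝ := S.piecewise φ fun _ => 0
  have hφ₀ : Measurable φ₀ := hcont.measurable_piecewise continuousOn_const hS
  have hφ₀S : ∀ p : Phase d, 0 ≤ p.1.1 → φ₀ p = φ p := fun p hp => piecewise_eq_of_mem S _ _ hp
  have hφ₀S' : ∀ p : Phase d, ¬ 0 ≤ p.1.1 → φ₀ p = 0 :=
    fun p hp => piecewise_eq_of_notMem S _ _ hp
  let V : ℕ → Phase d → Phase d := fun n p => (p.1, (p.2.1, dilVelocity R τ (ε n) p.2.1 p.2.2))
  have hV : ∀ n, Measurable (V n) := fun n =>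
    measurable_fst.prodMk ((measurable_fst.comp measurable_snd).prodMk
      ((measurable_dilVelocity R τ (ε n)).comp measurable_snd))
  let ψ : Phase d → ℝ := fun p => φ₀ p / (1 + |p.2.1|)
  have hψm : Measurable ψ := by fun_prop
  have hψC : ∀ p, |ψ p| ≤ C := fun p => by
    by_cases hp : 0 ≤ p.1.1
    · simp only [ψ, hφ₀S p hp, abs_div]
      rw [abs_of_nonneg (a := 1 + |p.2.1|) (by positivity)]
      exact hC p hp
    · simpa [ψ, hφ₀S' p hp] using hC0
  have hψK : ∀ p : Phase d, p.1 ∉ K → ψ p = 0 := fun p hpK => by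
    by_cases hp : 0 ≤ p.1.1
    · simp [ψ, hφ₀S p hp, hKφ p hp hpK]
    · simp [ψ, hφ₀S' p hp]
  have hψ : IsDualTest ψ := ⟨hψm, ⟨C, hψC⟩, K, hK, hψK⟩
  have hψV : ∀ n, IsDualTest fun p => ψ (V n p) :=
    fun n => ⟨hψm.comp (hV n), ⟨C, fun p => hψC _⟩, K, hK, fun p hp => hψK _ hp⟩
  -- The velocities tend to `ω` pointwise, so the moving tests differ from the fixed test `ψ` by
  -- bounded functions that tend to zero.
  have hdiff : Tendsto (fun n => ∫ p, weighted (G n) p * (ψ (V n p) - ψ p) ∂(phaseMeasure d R))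
      atTop (𝓝 0) := by
    refine h.tendsto_integral_of_tendsto_zero hM (C := C + C) hK
      (ψ := fun n p => ψ (V n p) - ψ p) (fun n => (hψm.comp (hV n)).sub hψm) (fun n => ?_)
      (fun n => ?_) (Eventually.of_forall fun p => ?_)
    · exact Eventually.of_forall fun p => (abs_sub _ _).trans (add_le_add (hψC _) (hψC _))
    · exact Eventually.of_forall fun p hp => by
        rw [hψK p hp, hψK (V n p) hp, sub_zero]
    · by_cases hp : 0 ≤ p.1.1
      · have hVlim : Tendsto (fun n => V n p) atTop (𝓝[S] p) := by
          refine tendsto_nhdsWithin_iff.2 ⟨?_, Eventually.of_forall fun n => hp⟩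
          exact tendsto_const_nhds.prodMk_nhds (tendsto_const_nhds.prodMk_nhds
            (tendsto_dilVelocity R hε _ _))
        have h1 : Tendsto (fun n => φ (V n p)) atTop (𝓝 (φ p)) := (hcont p hp).tendsto.comp hVlim
        have h2 := (h1.div_const (1 + |p.2.1|)).sub_const (φ p / (1 + |p.2.1|))
        rw [sub_self] at h2
        refine h2.congr fun n => ?_
        simp only [ψ, hφ₀S p hp, hφ₀S (V n p) hp]
        rfl
      · have : ∀ n, ψ (V n p) - ψ p = 0 := fun n => by
          simp only [ψ, hφ₀S' p hp, hφ₀S' (V n p) hp, zero_div, sub_zero]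
        simp [this]
  have hsum := (hgt.2.2 ψ hψ).add hdiff
  rw [add_zero] at hsum
  have key : ∀ g : Phase d → ℝ, ∀ p, weighted g p * ψ p = g p * φ₀ p := fun g p => by
    have := weighted_mul_div g φ₀ 1 p
    simpa using this
  have key' : ∀ n p, weighted (G n) p * ψ (V n p) = G n p * φ₀ (V n p) := fun n p => by
    have := weighted_mul_div (G n) (fun p => φ₀ (V n p)) 1 p
    simpa using this
  have hgoal : ∫ p, gt p * φ p ∂(phaseMeasure d R) =
      ∫ p, weighted gt p * ψ p ∂(phaseMeasure d R) := by
    refine integral_congr_ae ((ae_phaseMeasure_time_nonneg d R).mono fun p hp => ?_)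
    simp only [key, hφ₀S p hp]
  rw [hgoal]
  refine hsum.congr fun n => ?_
  rw [← integral_add (hψ.integrable_mul (hgt.1 n))
    (by
      simp only [mul_sub]
      exact ((hψV n).integrable_mul (hgt.1 n)).sub (hψ.integrable_mul (hgt.1 n)))]
  refine integral_congr_ae ((ae_phaseMeasure_time_nonneg d R).mono fun p hp => ?_)
  have h1 := key' n p
  rw [hφ₀S (V n p) hp] at h1
  simp only [mul_sub, add_sub_cancel]
  exact h1

/-! ### Integration with respect to the energy level -/

/-- The energy level moved to the last position. -/
def energyLastEquiv (X : Type*) [MeasurableSpace X] (d : ℕ) :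
    (X × Sp d) × ℝ ≃ᵐ X × (ℝ × Sp d) :=
  MeasurableEquiv.prodAssoc.trans
    (MeasurableEquiv.prodCongr (MeasurableEquiv.refl X) MeasurableEquiv.prodComm)

theorem measurePreserving_energyLastEquiv {X : Type*} [MeasurableSpace X] (μ : Measure X)
    [SFinite μ] (d : ℕ) (R : ℝ) :
    MeasurePreserving (energyLastEquiv X d) ((μ.prod (sphereMeasure d R)).prod volume)
      (μ.prod (energySphereMeasure d R)) :=
  ((MeasurePreserving.id μ).prod Measure.measurePreserving_swap).comp
    (measurePreserving_prodAssoc μ (sphereMeasure d R) volume)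

theorem memL1loc_of_weighted {d : ℕ} {R : ℝ} {F : Phase d → ℝ}
    (hF : MemL1loc d R (weighted F)) : MemL1loc d R F := fun K hK => by
  refine Integrable.mono (hF K hK) (aemeasurable_of_weighted hF).aestronglyMeasurable.restrict
    (Eventually.of_forall fun p => ?_)
  rw [Real.norm_eq_abs, Real.norm_eq_abs, weighted_abs]
  exact le_mul_of_one_le_left (abs_nonneg _) (by linarith [abs_nonneg p.2.1])

/-- The integral of a function over all the energy levels. -/
noncomputable def energyIntegral {d : ℕ} (F : Phase d → ℝ) (q : (ℝ × Sp d) × Sp d) : ℝ :=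
  ∫ u : ℝ, F (q.1, (u, q.2))

theorem integrable_energyLast {d : ℕ} {R : ℝ} {F : Phase d → ℝ} (hF : MemL1loc d R F)
    {K : Set (ℝ × Sp d)} (hK : IsCompact K) :
    Integrable (fun y : ((ℝ × Sp d) × Sp d) × ℝ =>
      (K ×ˢ (univ : Set (ℝ × Sp d))).indicator F (y.1.1, (y.2, y.1.2)))
      (((timeSpaceMeasure d).prod (sphereMeasure d R)).prod volume) := by
  have h := (integrable_indicator_iff (hK.measurableSet.prod MeasurableSet.univ)).2 (hF K hK)
  exact (measurePreserving_energyLastEquiv (timeSpaceMeasure d) d R).integrable_comp_of_integrable h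

theorem ae_integrable_energy {d : ℕ} {R : ℝ} {F : Phase d → ℝ} (hF : MemL1loc d R F) :
    ∀ᵐ q ∂((timeSpaceMeasure d).prod (sphereMeasure d R)),
      Integrable fun u : ℝ => F (q.1, (u, q.2)) := by
  have h := ae_all_iff.2 fun n => (integrable_energyLast hF
    (isCompact_compactCovering (ℝ × Sp d) n)).prod_right_ae
  filter_upwards [h] with q hq
  obtain ⟨n, hn⟩ := mem_iUnion.1 ((iUnion_compactCovering (ℝ × Sp d)).symm ▸ mem_univ q.1)
  refine (hq n).congr (Eventually.of_forall fun u => ?_)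
  exact indicator_of_mem (by exact ⟨hn, mem_univ _⟩) _

theorem locallyIntegrable_energyIntegral {d : ℕ} {R : ℝ} {F : Phase d → ℝ}
    (hF : MemL1loc d R F) :
    LocallyIntegrable (energyIntegral F) ((timeSpaceMeasure d).prod (sphereMeasure d R)) := by
  rw [locallyIntegrable_iff]
  intro K hK
  have hK' : IsCompact (Prod.fst '' K) := hK.image continuous_fst
  have h := (integrable_energyLast hF hK').integral_prod_left.integrableOn (s := K)
  refine h.congr_fun (fun q hq => ?_) hK.measurableSet
  refine integral_congr_ae (Eventually.of_forall fun u => ?_)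
  exact indicator_of_mem (by exact ⟨⟨q, hq, rfl⟩, mem_univ _⟩) _

theorem aestronglyMeasurable_energyIntegral {d : ℕ} {R : ℝ} {F : Phase d → ℝ}
    (hF : MemL1loc d R F) :
    AEStronglyMeasurable (energyIntegral F) ((timeSpaceMeasure d).prod (sphereMeasure d R)) :=
  (hF.aestronglyMeasurable.comp_measurePreserving
    (measurePreserving_energyLastEquiv (timeSpaceMeasure d) d R)).integral_prod_right'

theorem integral_mul_eq_energyIntegral {d : ℕ} {R : ℝ} {F : Phase d → ℝ} (hF : MemL1loc d R F)
    {φ : (ℝ × Sp d) × Sp d → ℝ} (hφ : Continuous φ) (hφc : HasCompactSupport φ) :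
    ∫ p, F p * φ (p.1, p.2.2) ∂(phaseMeasure d R) =
      ∫ q, energyIntegral F q * φ q ∂((timeSpaceMeasure d).prod (sphereMeasure d R)) := by
  obtain ⟨C, hC⟩ := hφ.bounded_above_of_compact_support hφc
  have hK : IsCompact (Prod.fst '' tsupport φ) := IsCompact.image hφc continuous_fst
  have hint : Integrable (fun p : Phase d => F p * φ (p.1, p.2.2)) (phaseMeasure d R) := by
    refine integrable_mul_of_memL1loc hF hK
      (ψ := fun p : Phase d => φ (p.1, p.2.2))
      (Continuous.aestronglyMeasurable (by fun_prop)) (Eventually.of_forall fun p => hC _)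
      (Eventually.of_forall fun p hp => ?_)
    exact image_eq_zero_of_notMem_tsupport fun h => hp ⟨_, h, rfl⟩
  have hmp := measurePreserving_energyLastEquiv (timeSpaceMeasure d) d R
  have h2 := hmp.integrable_comp_of_integrable hint
  rw [phaseMeasure, ← hmp.integral_comp']
  refine (integral_prod _ h2).trans (integral_congr_ae (Eventually.of_forall fun q => ?_))
  exact integral_mul_const (φ q) fun u : ℝ => F (q.1, (u, q.2))

theorem lintegral_inv_cosh_ne_top :
    ∫⁻ u : ℝ, ENNReal.ofReal ((Real.cosh (u / 2))⁻¹ ^ 2) ≠ ⊤ := by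
  have h := (integrable_pow_mul_exp_neg 0 one_pos).const_mul 4
  simp only [pow_zero, one_mul] at h
  refine ne_of_lt (lt_of_le_of_lt (lintegral_mono fun u => ?_) h.2)
  refine le_trans (ENNReal.ofReal_le_ofReal ?_) (Real.ofReal_le_enorm _)
  have h1 := halfVariance_le u
  unfold halfVariance at h1
  have h2 := Real.cosh_pos (u / 2)
  have h3 : (Real.cosh (u / 2))⁻¹ ^ 2 = 8 * (1 / (8 * Real.cosh (u / 2) ^ 2)) := by
    field_simp
  rw [h3]
  linarith

/-- Cauchy-Schwarz applied to `F = cosh⁻¹ * (F cosh)`. -/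
theorem sq_integral_le_mul_lintegral_cosh {F : ℝ → ℝ} (hF : AEStronglyMeasurable F) :
    ENNReal.ofReal ((∫ u, F u) ^ 2) ≤
      (∫⁻ u : ℝ, ENNReal.ofReal ((Real.cosh (u / 2))⁻¹ ^ 2)) *
        ∫⁻ u, ENNReal.ofReal ((F u * Real.cosh (u / 2)) ^ 2) := by
  have hsq : ∀ x : ℝ, ENNReal.ofReal (x ^ 2) = ‖x‖ₑ ^ (2 : ℝ) := fun x => by
    rw [ENNReal.rpow_two, ← enorm_pow, Real.enorm_of_nonneg (sq_nonneg x)]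
  have hcosh : Continuous fun u : ℝ => Real.cosh (u / 2) := by fun_prop
  have hc : Measurable fun u : ℝ => (Real.cosh (u / 2))⁻¹ := hcosh.measurable.inv
  have hFc : AEMeasurable fun u => F u * Real.cosh (u / 2) :=
    hF.aemeasurable.mul hcosh.measurable.aemeasurable
  simp_rw [hsq]
  have h1 := ENNReal.lintegral_mul_le_Lp_mul_Lq volume Real.HolderConjugate.two_two hc.enorm.aemeasurable
    hFc.enorm
  have h2 : ‖∫ u, F u‖ₑ ≤ ∫⁻ u, ((fun u => ‖(Real.cosh (u / 2))⁻¹‖ₑ) *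
      fun u => ‖F u * Real.cosh (u / 2)‖ₑ) u := by
    refine (enorm_integral_le_lintegral_enorm _).trans (le_of_eq (lintegral_congr fun u => ?_))
    have := (Real.cosh_pos (u / 2)).ne'
    rw [Pi.mul_apply, ← enorm_mul]
    congr 1
    field_simp
  calc ‖∫ u, F u‖ₑ ^ (2 : ℝ) ≤ _ := ENNReal.rpow_le_rpow (h2.trans h1) (by norm_num)
    _ = _ := by
      rw [ENNReal.mul_rpow_of_nonneg _ _ (by norm_num), ← ENNReal.rpow_mul, ← ENNReal.rpow_mul]
      norm_num

/-- Turns the `cosh` bound on `g̃` into the regularity of its energy integral, the candidate for the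
density of the weak* limit. -/
theorem memLinftyL2_energyIntegral {d : ℕ} {R c : ℝ} {F : Phase d → ℝ} (hF : MemL1loc d R F)
    (hc : ∀ᵐ t ∂timeMeasure, ∫⁻ z : Sp d × (ℝ × Sp d),
      ENNReal.ofReal ((F ((t, z.1), z.2) * Real.cosh (z.2.1 / 2)) ^ 2)
      ∂((volume : Measure (Sp d)).prod (energySphereMeasure d R)) ≤ ENNReal.ofReal c) :
    MemLinftyL2 d R (energyIntegral F) := by
  refine ⟨aestronglyMeasurable_energyIntegral hF,
    ((∫⁻ u : ℝ, ENNReal.ofReal ((Real.cosh (u / 2))⁻¹ ^ 2)) * ENNReal.ofReal c).toNNReal, ?_⟩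
  rw [ENNReal.coe_toNNReal (ENNReal.mul_ne_top lintegral_inv_cosh_ne_top ENNReal.ofReal_ne_top)]
  filter_upwards [hc, aemeasurable_slice_timeSpace hF.aestronglyMeasurable.aemeasurable]
    with t ht hm
  have hmp := measurePreserving_energyLastEquiv (volume : Measure (Sp d)) d R
  have hm' := hm.aestronglyMeasurable.comp_measurePreserving hmp
  have hcosh : Continuous fun u : ℝ => Real.cosh (u / 2) := by fun_prop
  have hsqm : AEMeasurable (fun z : Sp d × (ℝ × Sp d) =>
      ENNReal.ofReal ((F ((t, z.1), z.2) * Real.cosh (z.2.1 / 2)) ^ 2))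
      ((volume : Measure (Sp d)).prod (energySphereMeasure d R)) :=
    ((hm.mul (hcosh.measurable.comp (measurable_fst.comp measurable_snd)).aemeasurable).pow_const
      2).ennreal_ofReal
  have hsqm' := hsqm.comp_quasiMeasurePreserving hmp.quasiMeasurePreserving
  refine le_trans ?_ (mul_le_mul' le_rfl ht)
  have hlast := (hmp.lintegral_comp_emb (energyLastEquiv (Sp d) d).measurableEmbedding
    (fun z => ENNReal.ofReal ((F ((t, z.1), z.2) * Real.cosh (z.2.1 / 2)) ^ 2))).symm.trans
    (lintegral_prod _ hsqm')
  rw [hlast, ← lintegral_const_mul' _ _ lintegral_inv_cosh_ne_top]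
  exact lintegral_mono_ae (hm'.prodMk_left.mono fun y hy => sq_integral_le_mul_lintegral_cosh hy)

/-- Follows from `|g| ≤ 1 + g²` on compact sets; it is what identification of weak* limits by test
functions requires. -/
theorem MemLinftyL2.locallyIntegrable {d : ℕ} {R : ℝ} {g : (ℝ × Sp d) × Sp d → ℝ}
    (hg : MemLinftyL2 d R g) :
    LocallyIntegrable g ((timeSpaceMeasure d).prod (sphereMeasure d R)) := by
  obtain ⟨hm, C, hC⟩ := hg
  rw [locallyIntegrable_iff]
  intro K hK
  refine ⟨hm.restrict, ?_⟩
  let T : Set ℝ := (fun q : (ℝ × Sp d) × Sp d => q.1.1) '' K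
  have hT : IsCompact T := hK.image (by fun_prop)
  have hTm : Measurable (T.indicator (1 : ℝ → ENNReal)) := measurable_one.indicator hT.measurableSet
  have hg2 : AEMeasurable (fun q : (ℝ × Sp d) × Sp d => T.indicator (1 : ℝ → ENNReal) q.1.1 *
      ENNReal.ofReal (g q ^ 2)) ((timeSpaceMeasure d).prod (sphereMeasure d R)) :=
    (hTm.comp (measurable_fst.comp measurable_fst)).aemeasurable.mul
      (hm.aemeasurable.pow_const 2).ennreal_ofReal
  calc ∫⁻ q in K, ‖g q‖ₑ ∂((timeSpaceMeasure d).prod (sphereMeasure d R))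
      ≤ ∫⁻ q in K, 1 + T.indicator (1 : ℝ → ENNReal) q.1.1 * ENNReal.ofReal (g q ^ 2)
          ∂((timeSpaceMeasure d).prod (sphereMeasure d R)) := by
        refine setLIntegral_mono_ae' hK.measurableSet (Eventually.of_forall fun q hq => ?_)
        rw [indicator_of_mem (by exact ⟨q, hq, rfl⟩), Pi.one_apply, one_mul,
          Real.enorm_eq_ofReal_abs, ← ENNReal.ofReal_one, ← ENNReal.ofReal_add zero_le_one
            (sq_nonneg _)]
        refine ENNReal.ofReal_le_ofReal ?_
        rw [← sq_abs]
        nlinarith [sq_nonneg (|g q| - 1), abs_nonneg (g q)]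
    _ ≤ ((timeSpaceMeasure d).prod (sphereMeasure d R)) K +
          ∫⁻ q, T.indicator (1 : ℝ → ENNReal) q.1.1 * ENNReal.ofReal (g q ^ 2)
          ∂((timeSpaceMeasure d).prod (sphereMeasure d R)) := by
        rw [lintegral_add_left measurable_const, setLIntegral_one]
        exact add_le_add le_rfl (setLIntegral_le_lintegral _ _)
    _ < ⊤ := by
        refine ENNReal.add_lt_top.2 ⟨hK.measure_lt_top, ?_⟩
        rw [lintegral_slice_timeSpace hg2]
        calc _ ≤ ∫⁻ t, (C : ENNReal) * T.indicator (1 : ℝ → ENNReal) t ∂timeMeasure := by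
              refine lintegral_mono_ae (hC.mono fun t ht => ?_)
              by_cases h : t ∈ T
              · simpa [h] using ht
              · simp [h]
          _ = C * timeMeasure T := by
              rw [lintegral_const_mul _ hTm, lintegral_indicator_one hT.measurableSet]
          _ < ⊤ := ENNReal.mul_lt_top ENNReal.coe_lt_top hT.measure_lt_top

theorem ae_eq_of_weakStarTendsto {d : ℕ} {R : ℝ} {G : ℕ → ℝ → Sp d → Sp d → ℝ}
    {g g' : (ℝ × Sp d) × Sp d → ℝ}
    (hg : LocallyIntegrable g ((timeSpaceMeasure d).prod (sphereMeasure d R)))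
    (hg' : LocallyIntegrable g' ((timeSpaceMeasure d).prod (sphereMeasure d R)))
    (h : WeakStarTendsto d R G g) (h' : WeakStarTendsto d R G g') :
    ∀ᵐ q ∂((timeSpaceMeasure d).prod (sphereMeasure d R)), g q = g' q := by
  refine ae_eq_of_integral_contDiff_smul_eq hg hg' fun φ hφ hφc => ?_
  have := tendsto_nhds_unique (h φ hφ.continuous hφc) (h' φ hφ.continuous hφc)
  simpa only [smul_eq_mul, mul_comm] using this

theorem isGrowthTest_of_hasCompactSupport {d : ℕ} {φ : (ℝ × Sp d) × Sp d → ℝ}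
    (hφ : Continuous φ) (hφc : HasCompactSupport φ) :
    IsGrowthTest fun p : Phase d => φ (p.1, p.2.2) := by
  obtain ⟨C, hC⟩ := hφ.bounded_above_of_compact_support hφc
  refine ⟨Continuous.continuousOn (by fun_prop), ⟨Prod.fst '' tsupport φ,
    IsCompact.image hφc continuous_fst, fun p _ hp => ?_⟩, C, fun p _ => ?_⟩
  · exact image_eq_zero_of_notMem_tsupport fun h => hp ⟨_, h, rfl⟩
  · exact (div_le_self (abs_nonneg _) (by linarith [abs_nonneg p.2.1])).trans (hC _)

/-! ### The fluctuations -/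

theorem measurable_fermiDirac {d : ℕ} (δ R τ ε : ℝ) :
    Measurable fun v : Sp d => fermiDirac δ R τ ε v := by
  unfold fermiDirac; fun_prop

theorem tendsto_rpow_zero {ε : ℕ → ℝ} (hε : Tendsto ε atTop (𝓝 0)) {r : ℝ} (hr : 0 < r) :
    Tendsto (fun n => ε n ^ r) atTop (𝓝 0) := by
  have := hε.rpow_const (p := r) (Or.inr hr.le)
  rwa [Real.zero_rpow hr.ne'] at this

theorem weighted_surjective {d : ℕ} : Function.Surjective (weighted (d := d)) := fun G =>
  ⟨fun p => G p / (1 + |p.2.1|), funext fun p => mul_div_cancel₀ _ (by positivity)⟩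

/-! ### Application to entropy-bounded families. -/

namespace IsEntropyBoundedFamily

variable {d : ℕ} {δ R τ Cin : ℝ} {f : ℝ → ℝ → Sp d → Sp d → ℝ}

/-- `τ < 1` makes `η = ε^(1-τ)` vanish, and `τ > 0` makes `ε^τ` vanish, hence the convergence of the
Jacobian. -/
theorem exists_dominatedSeq (hf : IsEntropyBoundedFamily d δ R τ τ Cin f) (hd : 2 ≤ d)
    (hδ : 0 < δ) (hR : 0 < R) (hτ : 0 < τ) (hτ1 : τ < 1) {ε : ℕ → ℝ} (hpos : ∀ n, 0 < ε n)
    (hε : Tendsto ε atTop (𝓝 0)) :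
    ∃ J > 0, DominatedSeq d δ R Cin J (fun n => ε n ^ (1 - τ)) (fun n => jac d R (ε n ^ τ))
      (fun n => dilFluctuation δ R τ f (ε n)) (fun n => entropyDensity δ R τ f (ε n)) := by
  have hs := tendsto_rpow_zero hε hτ
  obtain ⟨s₀, hs₀⟩ := hs.bddAbove_range
  obtain ⟨J, hJ, hjac⟩ := exists_jac_le d hR s₀
  have hspos := fun n => Real.rpow_pos_of_pos (hpos n) τ
  exact ⟨J, hJ, fun n => Real.rpow_pos_of_pos (hpos n) _,
    tendsto_rpow_zero hε (sub_pos.2 hτ1), fun n => measurable_jac d R _,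
    fun n u => jac_nonneg hR u, fun n u => hjac _ (hspos n) (hs₀ ⟨n, rfl⟩) u,
    fun u => tendsto_jac hd hR hspos hs u, fun n => hf.dominated hd hδ hR (hpos n)⟩

theorem exists_lintegral_weighted_le (hf : IsEntropyBoundedFamily d δ R τ τ Cin f) (hd : 2 ≤ d)
    (hδ : 0 < δ) (hR : 0 < R) (hτ : 0 < τ) (hτ1 : τ < 1) {K : Set (Sp d)} (hK : IsCompact K)
    {ε₀ : ℝ} (hε₀ : 0 < ε₀) :
    ∃ C : NNReal, ∀ ε : ℝ, 0 < ε → ε ≤ ε₀ → ∀ᵐ t ∂timeMeasure,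
      ∫⁻ z in K ×ˢ (univ : Set (ℝ × Sp d)),
        ENNReal.ofReal |weighted (dilFluctuation δ R τ f ε) ((t, z.1), z.2)|
        ∂((volume : Measure (Sp d)).prod (energySphereMeasure d R)) ≤ (C : ENNReal) := by
  obtain ⟨J, hJ, hjac⟩ := exists_jac_le d hR (ε₀ ^ τ)
  obtain ⟨B, hB⟩ := EntropyDominated.exists_lintegral_weighted_le d (C := Cin) (R := R) hδ
    (Real.rpow_pos_of_pos hε₀ (1 - τ)) hJ.le hK
  refine ⟨B, fun ε hε hεε => hB _ _ _ _ ?_ (jac_nonneg hR) ?_ (hf.dominated hd hδ hR hε)⟩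
  · exact Real.rpow_le_rpow hε.le hεε (sub_pos.2 hτ1).le
  · exact hjac _ (Real.rpow_pos_of_pos hε τ) (Real.rpow_le_rpow hε.le hεε hτ.le)

theorem integral_fluctuation_mul (hf : IsEntropyBoundedFamily d δ R τ τ Cin f) (hd : 2 ≤ d)
    (hR : 0 < R) {ε : ℝ} (hε : 0 < ε) {φ : (ℝ × Sp d) × Sp d → ℝ} (hφ : Continuous φ) :
    ∫ q, fluctuation δ R τ f ε q.1.1 q.1.2 q.2 * φ q ∂((timeSpaceMeasure d).prod volume) =
      ∫ p, dilFluctuation δ R τ f ε p * φ (p.1, dilVelocity R τ ε p.2.1 p.2.2)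
        ∂(phaseMeasure d R) := by
  have hm : AEStronglyMeasurable (fun q : (ℝ × Sp d) × Sp d =>
      fluctuation δ R τ f ε q.1.1 q.1.2 q.2 * φ q) ((timeSpaceMeasure d).prod volume) :=
    ((((hf.aemeasurable ε hε).sub ((measurable_fermiDirac δ R τ ε).comp
      measurable_snd).aemeasurable).div_const ε).mul
        hφ.measurable.aemeasurable).aestronglyMeasurable
  rw [← integral_dilMap (τ := τ) hd hR hε hm]
  refine integral_congr_ae ?_
  filter_upwards [ae_prod_energySphere_norm (timeSpaceMeasure d) (d := d) hR] with p hp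
  rw [dilFluctuation_eq δ τ f ε hp]
  simp only [dilMap]
  ring

theorem ae_lintegral_cosh_le (hf : IsEntropyBoundedFamily d δ R τ τ Cin f) (hd : 2 ≤ d)
    (hδ : 0 < δ) (hR : 0 < R) (hC : 0 ≤ Cin) (hτ : 0 < τ) (hτ1 : τ < 1) {ε : ℕ → ℝ}
    (hpos : ∀ n, 0 < ε n) (hε : Tendsto ε atTop (𝓝 0)) {gt : Phase d → ℝ}
    (hgt : WeakTendsto d R (fun n => weighted (dilFluctuation δ R τ f (ε n))) (weighted gt)) :
    ∀ᵐ t ∂timeMeasure, ∫⁻ z : Sp d × (ℝ × Sp d),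
      ENNReal.ofReal ((gt ((t, z.1), z.2) * Real.cosh (z.2.1 / 2)) ^ 2)
      ∂((volume : Measure (Sp d)).prod (energySphereMeasure d R)) ≤
        ENNReal.ofReal (Cin / (4 * R * δ ^ 2)) := by
  obtain ⟨J, hJ, hdom⟩ := hf.exists_dominatedSeq hd hδ hR hτ hτ1 hpos hε
  exact hdom.ae_lintegral_cosh_le hδ hR hC hJ hgt

theorem tendsto_growthTest (hf : IsEntropyBoundedFamily d δ R τ τ Cin f) (hd : 2 ≤ d)
    (hδ : 0 < δ) (hR : 0 < R) (hτ : 0 < τ) (hτ1 : τ < 1) {ε : ℕ → ℝ} (hpos : ∀ n, 0 < ε n)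
    (hε : Tendsto ε atTop (𝓝 0)) {gt : Phase d → ℝ}
    (hgt : WeakTendsto d R (fun n => weighted (dilFluctuation δ R τ f (ε n))) (weighted gt))
    {φ : Phase d → ℝ} (hφ : IsGrowthTest φ) :
    Tendsto (fun n => ∫ p, dilFluctuation δ R τ f (ε n) p *
        φ (p.1, (p.2.1, dilVelocity R τ (ε n) p.2.1 p.2.2)) ∂(phaseMeasure d R)) atTop
      (𝓝 (∫ p, gt p * φ p ∂(phaseMeasure d R))) := by
  obtain ⟨J, hJ, hdom⟩ := hf.exists_dominatedSeq hd hδ hR hτ hτ1 hpos hε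
  obtain ⟨M, hM, A, B, hsplit⟩ := hdom.exists_splitSeq hδ hJ
  exact hsplit.tendsto_growthTest hM hgt (tendsto_rpow_zero hε hτ) hφ

theorem weaklyRelCompact_and_exists_subseq (hf : IsEntropyBoundedFamily d δ R τ τ Cin f)
    (hd : 2 ≤ d) (hδ : 0 < δ) (hR : 0 < R) (hτ : 0 < τ) (hτ1 : τ < 1) {ε : ℕ → ℝ}
    (hpos : ∀ n, 0 < ε n) (hε : Tendsto ε atTop (𝓝 0)) :
    WeaklyRelCompact d R (range fun n => weighted (dilFluctuation δ R τ f (ε n))) ∧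
      ∃ k : ℕ → ℕ, StrictMono k ∧ ∃ gt : Phase d → ℝ, WeakTendsto d R
        (fun n => weighted (dilFluctuation δ R τ f (ε (k n)))) (weighted gt) := by
  obtain ⟨J, hJ, hdom⟩ := hf.exists_dominatedSeq hd hδ hR hτ hτ1 hpos hε
  obtain ⟨M, hM, A, B, hsplit⟩ := hdom.exists_splitSeq hδ hJ
  obtain ⟨k, hk, G, hG⟩ := hsplit.exists_subseq hM
  obtain ⟨gt, rfl⟩ := weighted_surjective G
  exact ⟨hsplit.weaklyRelCompact hM, k, hk, gt, hG⟩

/-- In dilated variables a test `φ(t, x, v)` is a growth test independent of `u`, evaluated at the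
moving velocity. The limit has `v = ω`, and Fubini integrates out `u`. -/
theorem weakStarTendsto (hf : IsEntropyBoundedFamily d δ R τ τ Cin f) (hd : 2 ≤ d)
    (hδ : 0 < δ) (hR : 0 < R) (hτ : 0 < τ) (hτ1 : τ < 1) {ε : ℕ → ℝ} (hpos : ∀ n, 0 < ε n)
    (hε : Tendsto ε atTop (𝓝 0)) {gt : Phase d → ℝ}
    (hgt : WeakTendsto d R (fun n => weighted (dilFluctuation δ R τ f (ε n))) (weighted gt)) :
    WeakStarTendsto d R (fun n => fluctuation δ R τ f (ε n)) (energyIntegral gt) := by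
  intro φ hφ hφc
  rw [← integral_mul_eq_energyIntegral (memL1loc_of_weighted hgt.2.1) hφ hφc]
  simp_rw [fun n => hf.integral_fluctuation_mul hd hR (hpos n) hφ]
  exact hf.tendsto_growthTest hd hδ hR hτ hτ1 hpos hε hgt
    (isGrowthTest_of_hasCompactSupport hφ hφc)

end IsEntropyBoundedFamily

end FermiGas

/-! ### The main theorem. -/

theorem mainTheorem9 (d : ℕ) (hd : 2 ≤ d) (δ R τ γ Cin : ℝ) (hδ : 0 < δ) (hR : 0 < R)
    (hCin : 0 < Cin) (hγ : 0 < γ) (hγτ : γ = τ) (hτ : τ < 1)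
    (f : ℝ → ℝ → FermiGas.Sp d → FermiGas.Sp d → ℝ)
    (hf : FermiGas.IsEntropyBoundedFamily d δ R τ γ Cin f) :
    -- `(1+|u|) g̃_ε` is uniformly bounded in `L^∞(dt; L¹_loc(dx; L¹(dudω)))`
    (∀ K : Set (FermiGas.Sp d), IsCompact K → ∀ ε₀ > 0, ∃ C : NNReal, ∀ ε : ℝ, 0 < ε → ε ≤ ε₀ →
      ∀ᵐ t ∂FermiGas.timeMeasure,
        ∫⁻ z in K ×ˢ (Set.univ : Set (ℝ × FermiGas.Sp d)),
          ENNReal.ofReal |FermiGas.weighted (FermiGas.dilFluctuation δ R τ f ε) ((t, z.1), z.2)|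
          ∂((volume : Measure (FermiGas.Sp d)).prod (FermiGas.energySphereMeasure d R))
            ≤ (C : ENNReal)) ∧
    -- along any sequence `ε n → 0`, `(1+|u|) g̃_ε` is weakly relatively compact in
    -- `L¹_loc(dtdx; L¹(dudω))`, and a subsequence converges weakly; moreover a subsequence of the
    -- fluctuations `g_ε` has a weak* limit with a density `g` on the sphere
    (∀ ε : ℕ → ℝ, (∀ n, 0 < ε n) → Tendsto ε atTop (𝓝 0) →
      FermiGas.WeaklyRelCompact d R
        (Set.range fun n => FermiGas.weighted (FermiGas.dilFluctuation δ R τ f (ε n))) ∧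
      (∃ k : ℕ → ℕ, StrictMono k ∧ ∃ gt : FermiGas.Phase d → ℝ,
        FermiGas.WeakTendsto d R
          (fun n => FermiGas.weighted (FermiGas.dilFluctuation δ R τ f (ε (k n))))
          (FermiGas.weighted gt)) ∧
      (∃ k : ℕ → ℕ, StrictMono k ∧ ∃ g : (ℝ × FermiGas.Sp d) × FermiGas.Sp d → ℝ,
        FermiGas.MemLinftyL2 d R g ∧
        FermiGas.WeakStarTendsto d R (fun n => FermiGas.fluctuation δ R τ f (ε (k n))) g)) ∧
    -- properties of every weak limit point `g̃`, reached along a sequence `ε n → 0`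
    (∀ ε : ℕ → ℝ, (∀ n, 0 < ε n) → Tendsto ε atTop (𝓝 0) → ∀ gt : FermiGas.Phase d → ℝ,
      FermiGas.WeakTendsto d R
        (fun n => FermiGas.weighted (FermiGas.dilFluctuation δ R τ f (ε n)))
        (FermiGas.weighted gt) →
      (∀ g : (ℝ × FermiGas.Sp d) × FermiGas.Sp d → ℝ, FermiGas.MemLinftyL2 d R g →
        FermiGas.WeakStarTendsto d R (fun n => FermiGas.fluctuation δ R τ f (ε n)) g →
        ∀ᵐ q ∂((FermiGas.timeSpaceMeasure d).prod (FermiGas.sphereMeasure d R)),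
          Integrable (fun u : ℝ => gt (q.1, (u, q.2))) ∧
            ∫ u : ℝ, gt (q.1, (u, q.2)) = g q) ∧
      (∀ᵐ t ∂FermiGas.timeMeasure,
        ∫⁻ z : FermiGas.Sp d × (ℝ × FermiGas.Sp d),
          ENNReal.ofReal ((gt ((t, z.1), z.2) * Real.cosh (z.2.1 / 2)) ^ 2)
          ∂((volume : Measure (FermiGas.Sp d)).prod (FermiGas.energySphereMeasure d R))
            ≤ ENNReal.ofReal (Cin / (4 * R * δ ^ 2))) ∧
      (∀ φ : FermiGas.Phase d → ℝ, FermiGas.IsGrowthTest φ →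
        Tendsto (fun n => ∫ p, FermiGas.dilFluctuation δ R τ f (ε n) p *
            φ (p.1, (p.2.1, FermiGas.dilVelocity R τ (ε n) p.2.1 p.2.2))
            ∂(FermiGas.phaseMeasure d R)) atTop
          (𝓝 (∫ p, gt p * φ p ∂(FermiGas.phaseMeasure d R))))) := by
  subst hγτ
  refine ⟨fun K hK ε₀ hε₀ => hf.exists_lintegral_weighted_le hd hδ hR hγ hτ hK hε₀,
    fun ε hpos hε => ?_, fun ε hpos hε gt hgt => ?_⟩
  · obtain ⟨hcompact, k, hk, gt, hgt⟩ := hf.weaklyRelCompact_and_exists_subseq hd hδ hR hγ hτ hpos hε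
    have hεk : Tendsto (fun n => ε (k n)) atTop (𝓝 0) := hε.comp hk.tendsto_atTop
    have hposk : ∀ n, 0 < ε (k n) := fun n => hpos (k n)
    -- One subsequence serves both convergences, the weak* density being the energy integral of
    -- `gt`.
    refine ⟨hcompact, ⟨k, hk, gt, hgt⟩, k, hk, FermiGas.energyIntegral gt, ?_, ?_⟩
    · exact FermiGas.memLinftyL2_energyIntegral (FermiGas.memL1loc_of_weighted hgt.2.1)
        (hf.ae_lintegral_cosh_le hd hδ hR hCin.le hγ hτ hposk hεk hgt)
    · exact hf.weakStarTendsto hd hδ hR hγ hτ hposk hεk hgt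
  · have hloc := FermiGas.memL1loc_of_weighted hgt.2.1
    refine ⟨fun g hg hgstar => ?_,
      hf.ae_lintegral_cosh_le hd hδ hR hCin.le hγ hτ hpos hε hgt,
      fun φ hφ => hf.tendsto_growthTest hd hδ hR hγ hτ hpos hε hgt hφ⟩
    -- Both `g` and the energy integral of `gt` are weak* limit densities of the same sequence.
    have heq := FermiGas.ae_eq_of_weakStarTendsto
      (FermiGas.locallyIntegrable_energyIntegral hloc) hg.locallyIntegrable
      (hf.weakStarTendsto hd hδ hR hγ hτ hpos hε hgt) hgstar
    exact (FermiGas.ae_integrable_energy hloc).and heq
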